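/- Let $(\mathcal A,\otimes,k)$ be a bicomplete abelian category with a closed symmetric monoidal structure, and let $\mathcal P$ be a symmetric operad in $\mathcal A$ that is reduced: $\mathcal P_0=0$ and the unit $k\to\mathcal P_1$ is an isomorphism. For a $\mathcal P$-algebra $B$ write $\mu^B$ for its structure maps $\mathcal P_n\otimes B^{\otimes n}\to B$. An *action* of a $\mathcal P$-algebra $B$ on a $\mathcal P$-algebra $X$ is a morphism $\rho:\mathcal P\circ(B|X):=\bigoplus_n \mathcal P_n\otimes_{\Sigma_n}\big((X\oplus B)^{\otimes n}/B^{\otimes n}\big)\to X$ of $\mathcal A$ which restricts to $\mu^X$ on $\mathcal P(X)$ and is associative, i.e. compatible with the composition of $\mathcal P$, when an operation is evaluated on $X\oplus B$ by $(\rho,\mu^B)$. Every $B$ acts on itself, by $\mathcal P\circ(B|B)\hookrightarrow\mathcal P(B\oplus B)\to\mathcal P(B)\to B$. A *precrossed module* is an action of $V_0$ on $V_1$ with a morphism of $\mathcal P$-algebras $d:V_1\to V_0$ that is equivariant for this action and the action of $V_0$ on itself; a morphism is a pair of $\mathcal P$-algebra morphisms $V_1\to V_1'$, $V_0\to V_0'$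 compatible with the actions and with $d$, $d'$. It is a *crossed module* if it satisfies the Peiffer identity: for all $n\ge i\ge 2$, on $\mathcal P_n\otimes V_1^{\otimes i}\otimes V_0^{\otimes n-i}$, $$\rho=\rho\circ(\mathrm{Id}\otimes \mathrm{Id}_{V_1}\otimes d^{\otimes i-1}\otimes \mathrm{Id}).$$ $\mathrm{XMod}(\mathcal P\text{-alg})$ is the full subcategory of crossed modules. Let $Ch(\mathcal A)$ be the symmetric monoidal category of $\mathbb Z$-graded chain complexes in $\mathcal A$ (Koszul signs), let $\mathcal P$ be seen as an operad in $Ch(\mathcal A)$ concentrated in degree $0$, and let $\mathcal P\text{-alg}_{\le1}(Ch(\mathcal A))$ be the category of $\mathcal P$-algebras in $Ch(\mathcal A)$ whose complex is concentrated in degrees $0$ and $1$. **Proposition.** For every crossed module of $\mathcal P$-algebras $(V_0\overset{\rho}{\curvearrowright}V_1,\ d:V_1\to V_0)$, the following maps $\mu_n^k:(\mathcal P_n\otimes_{\Sigma_n} V^{\otimes n})_k\to V_k$ define a $\mathcal P$-algebra structure on the complex $V=(\cdots\to0\to V_1\overset{d}{\to}V_0\to0)$ in $Ch(\mathcal A)$,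 and it is the only $\mathcal P$-algebra structure on $V$ with these components: * $\mu_n^0:\mathcal P_n\otimes_{\Sigma_n} V_0^{\otimes n}\to V_0$ is the structure map $\mu^{V_0}$ of $V_0$; * $\mu_n^1:(\mathcal P_n\otimes_{\Sigma_n}V^{\otimes n})_1\to V_1$ is given by the $V_0$-$\mathcal P$-module structure of $V_1$, that is, by $\rho$ on tensors with exactly one factor in $V_1$ and the others in $V_0$; * $\mu_n^k=0$ for $k\ge2$. This construction is a functor $\mathrm{XMod}(\mathcal P\text{-alg})\to\mathcal P\text{-alg}_{\le1}(Ch(\mathcal A))$: it sends a crossed module to $V$ with this structure, and a morphism $(V_1\to V_1',\,V_0\to V_0')$ to the morphism of complexes with these components in degrees $1$ and $0$. -/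

import Mathlib

open CategoryTheory MonoidalCategory Limits

universe v u

namespace OpdX

noncomputable section

/-! ### Finite tensor products in a symmetric monoidal category -/

section Tensor

variable {C : Type u} [Category.{v} C] [MonoidalCategory C]

/-- The tensor product `F 0 ⊗ F 1 ⊗ ⋯ ⊗ F (n - 1)`, bracketed to the left. -/
@[reducible] def tens : {n : ℕ} → (Fin n → C) → C
  | 0, _ => 𝟙_ C
  | n + 1, F => tens (fun i : Fin n => F i.castSucc) ⊗ F (Fin.last n)

/-- The tensor power `X ^ ⊗ n`. -/
abbrev tpow (X : C) (n : ℕ) : C := tens (fun _ : Fin n => X)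

/-- The tensor product of a family of morphisms. -/
def tensMap : {n : ℕ} → {F G : Fin n → C} → (∀ i, F i ⟶ G i) → (tens F ⟶ tens G)
  | 0, _, _, _ => 𝟙 (𝟙_ C)
  | n + 1, _, _, f => tensMap (fun i : Fin n => f i.castSucc) ⊗ₘ f (Fin.last n)

theorem tensMap_id : {n : ℕ} → (F : Fin n → C) → tensMap (fun i => 𝟙 (F i)) = 𝟙 (tens F)
  | 0, _ => rfl
  | n + 1, F => by
      have h := tensMap_id (fun i : Fin n => F i.castSucc)
      simp only [tensMap, h]
      exact id_tensorHom_id _ _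

theorem tensMap_comp : {n : ℕ} → {F G H : Fin n → C} → (f : ∀ i, F i ⟶ G i) →
    (g : ∀ i, G i ⟶ H i) → tensMap (fun i => f i ≫ g i) = tensMap f ≫ tensMap g
  | 0, _, _, _, _, _ => (Category.comp_id (𝟙 (𝟙_ C))).symm
  | n + 1, _, _, _, f, g => by
      have h := tensMap_comp (fun i : Fin n => f i.castSucc) (fun i : Fin n => g i.castSucc)
      simp only [tensMap, h]
      exact (tensorHom_comp_tensorHom _ _ _ _).symm

/-- The first `a` positions, the middle `m` positions and the last `b` positions
among `a + m + b`. -/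
abbrev posL (a m b : ℕ) (i : Fin a) : Fin (a + m + b) := Fin.castAdd b (Fin.castAdd m i)
/-- See `posL`. -/
abbrev posM (a m b : ℕ) (i : Fin m) : Fin (a + m + b) := Fin.castAdd b (Fin.natAdd a i)
/-- See `posL`. -/
abbrev posR (a m b : ℕ) (i : Fin b) : Fin (a + m + b) := Fin.natAdd (a + m) i

/-- The canonical isomorphism cutting a tensor product of `a + b` factors into two blocks. -/
def tensSplit (a : ℕ) : (b : ℕ) → (F : Fin (a + b) → C) →
    (tens F ≅ tens (fun i : Fin a => F (Fin.castAdd b i)) ⊗ tens (fun j : Fin b => F (Fin.natAdd a j)))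
  | 0, F => (ρ_ (tens F)).symm
  | b + 1, F =>
      whiskerRightIso (tensSplit a b (fun i => F i.castSucc)) (F (Fin.last (a + b))) ≪≫ α_ _ _ _

/-- The canonical isomorphism cutting a tensor product of `a + m + b` factors into three blocks. -/
def tensSplit₃ (a m b : ℕ) (F : Fin (a + m + b) → C) :
    tens F ≅ (tens (fun i => F (posL a m b i)) ⊗ tens (fun i => F (posM a m b i))) ⊗
      tens (fun i => F (posR a m b i)) :=
  tensSplit (a + m) b F ≪≫
    whiskerRightIso (tensSplit a m (fun i => F (Fin.castAdd b i))) _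

variable [SymmetricCategory C]

/-- Move the `i`-th factor of a tensor product to the last place, by the symmetry. -/
def tensExtract : {n : ℕ} → (F : Fin (n + 1) → C) → (i : Fin (n + 1)) →
    (tens F ⟶ tens (fun j => F (i.succAbove j)) ⊗ F i)
  | 0, F, i => (𝟙_ C) ◁ eqToHom (congrArg F (Subsingleton.elim (α := Fin 1) _ _))
  | n + 1, F, i =>
      if h : i = Fin.last (n + 1) then
        tensMap (fun j => eqToHom (congrArg F (by rw [h, Fin.succAbove_last]))) ⊗ₘ
          eqToHom (congrArg F h.symm)
      else
        tensExtract (fun j : Fin (n + 1) => F j.castSucc) (i.castPred h) ▷ F (Fin.last (n + 1)) ≫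
          (α_ _ _ _).hom ≫ _ ◁ (β_ _ _).hom ≫ (α_ _ _ _).inv ≫
          ((tensMap (fun j : Fin n => eqToHom (congrArg F (by
              rw [← Fin.castSucc_succAbove_castSucc, Fin.castSucc_castPred]))) ⊗ₘ
            eqToHom (congrArg F (Fin.succAbove_ne_last_last h).symm)) ⊗ₘ
            eqToHom (congrArg F (Fin.castSucc_castPred i h)))

/-- The permutation `τ` of the first `n` positions with
`(σ last).succAbove (τ j) = σ j.castSucc`. -/
def residual {n : ℕ} (σ : Equiv.Perm (Fin (n + 1))) : Equiv.Perm (Fin n) :=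
  (finSuccAboveEquiv (Fin.last n)).trans
    ((σ.subtypeEquiv (fun x => by simp)).trans (finSuccAboveEquiv (σ (Fin.last n))).symm)

theorem residual_spec {n : ℕ} (σ : Equiv.Perm (Fin (n + 1))) (j : Fin n) :
    (σ (Fin.last n)).succAbove (residual σ j) = σ j.castSucc := by
  have h : ((finSuccAboveEquiv (σ (Fin.last n)) (residual σ j) : Fin (n + 1))) = σ j.castSucc := by
    simp only [residual, Equiv.trans_apply, Equiv.apply_symm_apply]
    simp [finSuccAboveEquiv_apply]
  simpa only [finSuccAboveEquiv_apply] using h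

/-- The permutation of tensor factors `x₀ ⊗ ⋯ ⊗ xₙ₋₁ ↦ x_{σ 0} ⊗ ⋯ ⊗ x_{σ (n-1)}`, by the
symmetry. -/
def tensPerm : {n : ℕ} → (σ : Equiv.Perm (Fin n)) → (F : Fin n → C) →
    (tens F ⟶ tens (fun i => F (σ i)))
  | 0, _, _ => 𝟙 (𝟙_ C)
  | n + 1, σ, F =>
      tensExtract F (σ (Fin.last n)) ≫
        (tensPerm (residual σ) (fun j => F ((σ (Fin.last n)).succAbove j)) ≫
          tensMap (fun j => eqToHom (congrArg F (residual_spec σ j)))) ▷ _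

/-- Plug a morphism into a block of consecutive factors: from `f : Q ⊗ (middle block) ⟶ Y` and
morphisms on the remaining factors, the morphism `Q ⊗ (a + m + b factors) ⟶ (a + 1 + b factors)`
moving `Q` past the first `a` factors and applying `f` to it and the `m` middle ones. -/
def plug (a m b : ℕ) {F : Fin (a + m + b) → C} {G : Fin (a + 1 + b) → C} {Q : C}
    (l : ∀ i, F (posL a m b i) ⟶ G (posL a 1 b i))
    (f : Q ⊗ tens (fun i => F (posM a m b i)) ⟶ G (posM a 1 b 0))
    (r : ∀ i, F (posR a m b i) ⟶ G (posR a 1 b i)) :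
    Q ⊗ tens F ⟶ tens G :=
  Q ◁ (tensSplit₃ a m b F).hom ≫ (α_ _ _ _).inv ≫
    ((α_ _ _ _).inv ≫ (β_ _ _).hom ▷ _ ≫ (α_ _ _ _).hom ≫
      (tensMap l ⊗ₘ (f ≫ (λ_ _).inv))) ▷ _ ≫
    _ ◁ tensMap r ≫ (tensSplit₃ a 1 b G).inv

end Tensor

/-! ### Symmetric operads and their algebras -/

section Operad

/-- The embedding of the `a + b` outer positions among `a + m + b`. -/
def outer (a m b : ℕ) : Fin a ⊕ Fin b → Fin (a + m + b) :=
  Sum.elim (posL a m b) (posR a m b)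

/-- `ω` is the bijection of the positions of `p ∘ q` induced by a bijection `σ` of the positions of
`p` (matching the positions in which `q` is inserted) and a bijection `τ` of the positions
of `q`. -/
def IsGraft {a b m a' b' m' : ℕ} (σ : Fin (a + 1 + b) ≃ Fin (a' + 1 + b')) (τ : Fin m ≃ Fin m')
    (ω : Fin (a + m + b) ≃ Fin (a' + m' + b')) : Prop :=
  σ (posM a 1 b 0) = posM a' 1 b' 0 ∧
  (∀ j, ω (posM a m b j) = posM a' m' b' (τ j)) ∧
  ∀ x y, σ (outer a 1 b x) = outer a' 1 b' y → ω (outer a m b x) = outer a' m' b' y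

/-- A symmetric operad in a symmetric monoidal category, by partial compositions.
`act σ` relabels input `i` as input `σ i`; the right action of `σ` in the symmetric group is
`act σ⁻¹`. The morphism `comp a b m` is the partial composition inserting an operation of
arity `m` in the input number `a + 1` of an operation of arity `a + 1 + b`. -/
structure SymmOperad (C : Type u) [Category.{v} C] [MonoidalCategory C]
    [SymmetricCategory C] where
  /-- The object of operations of arity `n`. -/
  obj : ℕ → C
  /-- The action of bijections. -/
  act : ∀ {m n : ℕ}, (Fin m ≃ Fin n) → (obj m ⟶ obj n)
  /-- The identity operation. -/
  unit : 𝟙_ C ⟶ obj 1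
  /-- The partial compositions. -/
  comp : ∀ a b m : ℕ, obj (a + 1 + b) ⊗ obj m ⟶ obj (a + m + b)
  act_refl : ∀ n, act (Equiv.refl (Fin n)) = 𝟙 (obj n)
  act_trans : ∀ {l m n : ℕ} (σ : Fin l ≃ Fin m) (τ : Fin m ≃ Fin n),
    act (σ.trans τ) = act σ ≫ act τ
  act_comp : ∀ {a b m a' b' m' : ℕ} (σ : Fin (a + 1 + b) ≃ Fin (a' + 1 + b'))
    (τ : Fin m ≃ Fin m') (ω : Fin (a + m + b) ≃ Fin (a' + m' + b')), IsGraft σ τ ω →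
    (act σ ⊗ₘ act τ) ≫ comp a' b' m' = comp a b m ≫ act ω
  unit_comp : ∀ m, unit ▷ obj m ≫ comp 0 0 m = (λ_ _).hom ≫ act (finCongr (by omega))
  comp_unit : ∀ a b, obj (a + 1 + b) ◁ unit ≫ comp a b 1 = (ρ_ _).hom
  /-- Sequential associativity. -/
  comp_seq : ∀ a b c d m : ℕ,
    comp a b (c + 1 + d) ▷ obj m ≫
        act (finCongr (show a + (c + 1 + d) + b = (a + c) + 1 + (d + b) by omega)) ▷ obj m ≫
        comp (a + c) (d + b) m =
      (α_ _ _ _).hom ≫ obj (a + 1 + b) ◁ comp c d m ≫ comp a b (c + m + d) ≫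
        act (finCongr (show a + (c + m + d) + b = (a + c) + m + (d + b) by omega))
  /-- Parallel associativity. -/
  comp_par : ∀ a b c m n : ℕ,
    (act (finCongr (show a + 1 + b + 1 + c = a + 1 + (b + 1 + c) by omega)) ▷ obj m ≫
          comp a (b + 1 + c) m ≫
          act (finCongr (show a + m + (b + 1 + c) = (a + m + b) + 1 + c by omega))) ▷ obj n ≫
        comp (a + m + b) c n =
      (α_ _ _ _).hom ≫ _ ◁ (β_ _ _).hom ≫ (α_ _ _ _).inv ≫
        (comp (a + 1 + b) c n ≫
          act (finCongr (show a + 1 + b + n + c = a + 1 + (b + n + c) by omega))) ▷ obj m ≫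
        comp a (b + n + c) m ≫
        act (finCongr (show a + m + (b + n + c) = (a + m + b) + n + c by omega))

variable {C : Type u} [Category.{v} C] [MonoidalCategory C] [SymmetricCategory C]

/-- An operad is reduced if there is no operation of arity zero and the object of operations of
arity one is the tensor unit. -/
def SymmOperad.IsReduced (P : SymmOperad C) : Prop :=
  IsZero (P.obj 0) ∧ IsIso P.unit

/-- An algebra over the operad `P` in `C`. -/
structure Alg (P : SymmOperad C) where
  /-- The underlying object. -/
  X : C
  /-- The structure morphisms. -/
  op : ∀ n, P.obj n ⊗ tpow X n ⟶ X
  op_act : ∀ {n} (σ : Equiv.Perm (Fin n)),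
    P.act σ ▷ tpow X n ≫ op n = P.obj n ◁ tensPerm σ (fun _ => X) ≫ op n
  op_unit : P.unit ▷ tpow X 1 ≫ op 1 = (λ_ _).hom ≫ (λ_ X).hom
  op_comp : ∀ a b m,
    P.comp a b m ▷ tpow X (a + m + b) ≫ op (a + m + b) =
      (α_ _ _ _).hom ≫ P.obj (a + 1 + b) ◁ plug a m b (fun _ => 𝟙 X) (op m) (fun _ => 𝟙 X) ≫
        op (a + 1 + b)

namespace Alg

variable {P : SymmOperad C}

/-- A morphism of algebras over an operad. -/
@[ext]
structure Hom (A B : Alg P) where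
  /-- The underlying morphism. -/
  hom : A.X ⟶ B.X
  op_hom : ∀ n, A.op n ≫ hom = P.obj n ◁ tensMap (fun _ => hom) ≫ B.op n

instance : Category (Alg P) where
  Hom A B := Hom A B
  id A := ⟨𝟙 A.X, fun n => by simp [tensMap_id]⟩
  comp f g := ⟨f.hom ≫ g.hom, fun n => by
    rw [← Category.assoc, f.op_hom, Category.assoc, g.op_hom, tensMap_comp]; simp⟩

@[simp] theorem id_hom (A : Alg P) : Hom.hom (𝟙 A) = 𝟙 A.X := rfl

@[simp] theorem comp_hom {A B D : Alg P} (f : A ⟶ B) (g : B ⟶ D) :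
    Hom.hom (f ≫ g) = f.hom ≫ g.hom := rfl

end Alg

end Operad

/-! ### Internal actions and crossed modules -/

section Crossed

variable {C : Type u} [Category.{v} C] [Abelian C] [MonoidalCategory C] [SymmetricCategory C]
variable {P : SymmOperad C}

/-- From `ρ : P n ⊗ (X ⊕ B) ^ ⊗ n ⟶ X`, the morphism
`(ρ, μ_B) : P n ⊗ (X ⊕ B) ^ ⊗ n ⟶ X ⊕ B`. -/
def extendOp (B : Alg P) {X : C} {n : ℕ} (ρ : P.obj n ⊗ tpow (X ⊞ B.X) n ⟶ X) :
    P.obj n ⊗ tpow (X ⊞ B.X) n ⟶ X ⊞ B.X :=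
  biprod.lift ρ (P.obj n ◁ tensMap (fun _ => biprod.snd) ≫ B.op n)

/-- An internal action of `B` on `X`. A morphism from
`⨁ n, P n ⊗_{Σ n} ((X ⊕ B) ^ ⊗ n / B ^ ⊗ n)` to `X` is the same thing as a family of morphisms
`P n ⊗ (X ⊕ B) ^ ⊗ n ⟶ X` that are invariant under the symmetric groups (`ρ_act`) and vanish
on `P n ⊗ B ^ ⊗ n` (`ρ_base`). -/
structure Action (B X : Alg P) where
  /-- The components of the action. -/
  ρ : ∀ n, P.obj n ⊗ tpow (X.X ⊞ B.X) n ⟶ X.X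
  ρ_act : ∀ {n} (σ : Equiv.Perm (Fin n)),
    P.act σ ▷ tpow (X.X ⊞ B.X) n ≫ ρ n = P.obj n ◁ tensPerm σ (fun _ => X.X ⊞ B.X) ≫ ρ n
  ρ_base : ∀ n, P.obj n ◁ tensMap (fun _ : Fin n => (biprod.inr : B.X ⟶ X.X ⊞ B.X)) ≫ ρ n = 0
  /-- Compatibility with the structure map of `X`. -/
  ρ_compat : ∀ n,
    P.obj n ◁ tensMap (fun _ : Fin n => (biprod.inl : X.X ⟶ X.X ⊞ B.X)) ≫ ρ n = X.op n
  /-- Associativity of the action. -/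
  ρ_comp : ∀ a b m,
    P.comp a b m ▷ tpow (X.X ⊞ B.X) (a + m + b) ≫ ρ (a + m + b) =
      (α_ _ _ _).hom ≫
        P.obj (a + 1 + b) ◁ plug a m b (fun _ => 𝟙 _) (extendOp B (ρ m)) (fun _ => 𝟙 _) ≫
        ρ (a + 1 + b)

/-- The components of the natural action of an algebra `B` on itself. The first morphism is the
projection of `(B ⊕ B) ^ ⊗ n` onto the complement `(B ⊕ B) ^ ⊗ n / B ^ ⊗ n` of its second copy of
`B ^ ⊗ n`, followed by the inclusion. -/
def selfAction (B : Alg P) (n : ℕ) : P.obj n ⊗ tpow (B.X ⊞ B.X) n ⟶ B.X :=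
  P.obj n ◁ ((𝟙 _ - tensMap (fun _ : Fin n => (biprod.snd ≫ biprod.inr : B.X ⊞ B.X ⟶ B.X ⊞ B.X))) ≫
    tensMap (fun _ => biprod.desc (𝟙 B.X) (𝟙 B.X))) ≫ B.op n

/-- A precrossed module: an action of `base` on `top` and an equivariant morphism of algebras
`d : top ⟶ base`. -/
structure PreXMod (P : SymmOperad C) where
  /-- The algebra which acts. -/
  base : Alg P
  /-- The algebra which is acted upon. -/
  top : Alg P
  /-- The action. -/
  action : Action base top
  /-- The boundary morphism. -/
  d : top ⟶ base
  equivariant : ∀ n,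
    action.ρ n ≫ d.hom =
      P.obj n ◁ tensMap (fun _ => biprod.map d.hom (𝟙 base.X)) ≫ selfAction base n

namespace PreXMod

/-- A morphism of precrossed modules: a morphism of actions commuting with the boundaries. -/
@[ext]
structure Hom (M N : PreXMod P) where
  /-- The morphism between the algebras which act. -/
  base : M.base ⟶ N.base
  /-- The morphism between the algebras which are acted upon. -/
  top : M.top ⟶ N.top
  action : ∀ n, M.action.ρ n ≫ top.hom =
    P.obj n ◁ tensMap (fun _ => biprod.map top.hom base.hom) ≫ N.action.ρ n
  comm : M.d ≫ base = top ≫ N.d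

instance : Category (PreXMod P) where
  Hom M N := Hom M N
  id M := ⟨𝟙 _, 𝟙 _, fun n => by
    have h : biprod.map (Alg.Hom.hom (𝟙 M.top)) (Alg.Hom.hom (𝟙 M.base)) =
      𝟙 (M.top.X ⊞ M.base.X) := by
        apply biprod.hom_ext <;> simp
    simp only [h, tensMap_id]
    exact (Category.comp_id _).trans (by simp), by simp⟩
  comp f g := ⟨f.base ≫ g.base, f.top ≫ g.top, fun n => by
    have h : biprod.map (Alg.Hom.hom (f.top ≫ g.top)) (Alg.Hom.hom (f.base ≫ g.base)) =
      biprod.map f.top.hom f.base.hom ≫ biprod.map g.top.hom g.base.hom := by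
        apply biprod.hom_ext <;> simp
    have h' : Alg.Hom.hom (f.top ≫ g.top) = f.top.hom ≫ g.top.hom := rfl
    rw [h, h', ← Category.assoc, f.action, Category.assoc, g.action, tensMap_comp]
    simp, by rw [← Category.assoc, f.comm, Category.assoc, g.comm, Category.assoc]⟩

/-- The Peiffer identity: on `P n ⊗ (X ^ ⊗ i ⊗ B ^ ⊗ (n - i))`, with `i = 1 + j` and
`n = 1 + j + r`, the action does not change when `d` is applied to all copies of `X` but the
first one. -/
def Peiffer (M : PreXMod P) : Prop :=
  ∀ j r : ℕ,
    P.obj (1 + j + r) ◁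
        (((tensMap (fun _ : Fin 1 => (biprod.inl : M.top.X ⟶ M.top.X ⊞ M.base.X)) ⊗ₘ
            tensMap (fun _ : Fin j => (biprod.inl : M.top.X ⟶ M.top.X ⊞ M.base.X))) ⊗ₘ
            tensMap (fun _ : Fin r => (biprod.inr : M.base.X ⟶ M.top.X ⊞ M.base.X))) ≫
          (tensSplit₃ 1 j r (fun _ => M.top.X ⊞ M.base.X)).inv) ≫
        M.action.ρ (1 + j + r) =
      P.obj (1 + j + r) ◁
        (((tensMap (fun _ : Fin 1 => (biprod.inl : M.top.X ⟶ M.top.X ⊞ M.base.X)) ⊗ₘ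
            tensMap (fun _ : Fin j => (M.d.hom ≫ biprod.inr : M.top.X ⟶ M.top.X ⊞ M.base.X))) ⊗ₘ
            tensMap (fun _ : Fin r => (biprod.inr : M.base.X ⟶ M.top.X ⊞ M.base.X))) ≫
          (tensSplit₃ 1 j r (fun _ => M.top.X ⊞ M.base.X)).inv) ≫
        M.action.ρ (1 + j + r)

end PreXMod

/-- The category of crossed modules, a full subcategory of that of precrossed modules. -/
abbrev XMod (P : SymmOperad C) : Type _ :=
  ObjectProperty.FullSubcategory (fun M : PreXMod P => M.Peiffer)

end Crossed

/-! ### Algebras in chain complexes -/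

section DG

variable {C : Type u} [Category.{v} C] [Abelian C] [MonoidalCategory C] [SymmetricCategory C]

/-- The Koszul sign of the permutation `x₀ ⊗ ⋯ ⊗ xₙ₋₁ ↦ x_{σ 0} ⊗ ⋯ ⊗ x_{σ (n-1)}` of homogeneous
elements, with `xᵢ` of degree `w i`. -/
def koszulSign {n : ℕ} (σ : Equiv.Perm (Fin n)) (w : Fin n → ℤ) : ℤˣ :=
  ∏ i, ∏ j, if i < j ∧ σ j < σ i then (w (σ i) * w (σ j)).negOnePow else 1

/-- The word `w` with its `i`-th letter lowered by one. -/
def lower {n : ℕ} (w : Fin n → ℤ) (i : Fin n) : Fin n → ℤ := Function.update w i (w i - 1)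

theorem sum_lower {n : ℕ} (w : Fin n → ℤ) (i : Fin n) : ∑ j, lower w i j = (∑ j, w j) - 1 := by
  rw [lower, Finset.sum_update_of_mem (Finset.mem_univ i),
    ← Finset.add_sum_erase Finset.univ w (Finset.mem_univ i), Finset.sdiff_singleton_eq_erase]
  ring

/-- The differential applied to the `i`-th tensor factor, without sign. -/
def dAt (V : ChainComplex C ℤ) {n : ℕ} (w : Fin n → ℤ) (i : Fin n) :
    tens (fun j => V.X (w j)) ⟶ tens (fun j => V.X (lower w i j)) :=
  tensMap (fun j =>
    if h : j = i then V.d (w j) (lower w i j)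
    else eqToHom (congrArg V.X (by simp [lower, h])))

/-- A structure of algebra over the operad `P` of `C` (seen as an operad in chain complexes,
concentrated in degree zero) on a chain complex `V`. As
`(V ^ ⊗ n)_k = ⨁_{w₁ + ⋯ + wₙ = k} V_{w₁} ⊗ ⋯ ⊗ V_{wₙ}`, and tensor products commute with direct
sums, the structure morphism `P n ⊗ V ^ ⊗ n ⟶ V` is given by its components, indexed by the
words `w`. The symmetry and the differential of `V ^ ⊗ n` are those of the tensor product of
complexes, with the Koszul signs. -/
@[ext]
structure DGStr (P : SymmOperad C) (V : ChainComplex C ℤ) where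
  /-- The components of the structure morphisms. -/
  op : ∀ {n} (w : Fin n → ℤ) (k : ℤ), ∑ i, w i = k →
    (P.obj n ⊗ tens (fun i => V.X (w i)) ⟶ V.X k)
  op_d : ∀ {n} (w : Fin n → ℤ) (k : ℤ) (h : ∑ i, w i = k),
    op w k h ≫ V.d k (k - 1) =
      ∑ i, (∑ j ∈ Finset.Iio i, w j).negOnePow •
        (P.obj n ◁ dAt V w i ≫ op (lower w i) (k - 1) (by rw [sum_lower, h]))
  op_act : ∀ {n} (σ : Equiv.Perm (Fin n)) (w : Fin n → ℤ) (k : ℤ) (h : ∑ i, w i = k),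
    P.act σ ▷ tens (fun i => V.X (w i)) ≫ op w k h =
      koszulSign σ w • (P.obj n ◁ tensPerm σ (fun i => V.X (w i)) ≫
        op (fun i => w (σ i)) k (by rw [Equiv.sum_comp σ w, h]))
  op_unit : ∀ (w : Fin 1 → ℤ),
    P.unit ▷ tens (fun i => V.X (w i)) ≫ op w (w 0) (by simp) =
      (λ_ _).hom ≫ (λ_ (V.X (w 0))).hom
  op_comp : ∀ (a b m : ℕ) (w : Fin (a + m + b) → ℤ) (w' : Fin (a + 1 + b) → ℤ) (k : ℤ)
    (h : ∑ i, w i = k) (h' : ∑ i, w' i = k)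
    (hl : ∀ i, w (posL a m b i) = w' (posL a 1 b i))
    (hm : ∑ i, w (posM a m b i) = w' (posM a 1 b 0))
    (hr : ∀ i, w (posR a m b i) = w' (posR a 1 b i)),
    P.comp a b m ▷ tens (fun i => V.X (w i)) ≫ op w k h =
      (α_ _ _ _).hom ≫
        P.obj (a + 1 + b) ◁ plug a m b (F := fun i => V.X (w i)) (G := fun i => V.X (w' i))
          (fun i => eqToHom (congrArg V.X (hl i)))
          (op (fun i => w (posM a m b i)) _ hm)
          (fun i => eqToHom (congrArg V.X (hr i))) ≫
        op w' k h'

/-- A differential graded algebra over the operad `P`. -/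
structure DGAlg (P : SymmOperad C) where
  /-- The underlying complex. -/
  cx : ChainComplex C ℤ
  /-- The algebra structure. -/
  str : DGStr P cx

namespace DGAlg

variable {P : SymmOperad C}

/-- A morphism of differential graded algebras: a morphism of complexes compatible with the
structure morphisms. -/
@[ext]
structure Hom (A B : DGAlg P) where
  /-- The underlying morphism of complexes. -/
  hom : A.cx ⟶ B.cx
  op_hom : ∀ {n} (w : Fin n → ℤ) (k : ℤ) (h : ∑ i, w i = k),
    A.str.op w k h ≫ hom.f k = P.obj n ◁ tensMap (fun i => hom.f (w i)) ≫ B.str.op w k h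

instance : Category (DGAlg P) where
  Hom A B := Hom A B
  id A := ⟨𝟙 A.cx, fun w k h => by simp [tensMap_id]⟩
  comp f g := ⟨f.hom ≫ g.hom, fun w k h => by
    simp only [HomologicalComplex.comp_f]
    rw [← Category.assoc, f.op_hom, Category.assoc, g.op_hom, tensMap_comp]; simp⟩

end DGAlg

/-- A complex is concentrated in degrees `0` and `1`. -/
def InDegreesZeroOne (V : ChainComplex C ℤ) : Prop := ∀ k : ℤ, k ≠ 0 → k ≠ 1 → IsZero (V.X k)

/-- The category of differential graded `P`-algebras concentrated in degrees `0` and `1`. -/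
abbrev DGAlgLEOne (P : SymmOperad C) : Type _ :=
  ObjectProperty.FullSubcategory (fun A : DGAlg P => InDegreesZeroOne A.cx)

end DG

/-! ### The complex of a crossed module -/

section TwoTerm

open ZeroObject

variable {C : Type u} [Category.{v} C] [Abelian C]

/-- The complex `⋯ ⟶ 0 ⟶ V₁ ⟶ V₀ ⟶ 0 ⟶ ⋯` with `V₁` in degree `1` and `V₀` in degree `0`. -/
def twoTerm {V₁ V₀ : C} (d : V₁ ⟶ V₀) : ChainComplex C ℤ where
  X k := match k with
    | .ofNat 0 => V₀
    | .ofNat 1 => V₁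
    | _ => 0
  d i j := match i, j with
    | .ofNat 1, .ofNat 0 => d
    | _, _ => 0
  shape i j h := by
    split
    · exact absurd rfl h
    · rfl
  d_comp_d' i j k _ _ := by
    split
    · exact comp_zero
    · exact zero_comp

theorem twoTerm_d_eq_zero {V₁ V₀ : C} (d : V₁ ⟶ V₀) {i j : ℤ} (h : ¬ (i = 1 ∧ j = 0)) :
    (twoTerm d).d i j = 0 := by
  dsimp only [twoTerm]
  split
  · exact absurd ⟨rfl, rfl⟩ h
  · rfl

/-- The morphism between two-term complexes induced by a commutative square. -/
def twoTermMap {V₁ V₀ W₁ W₀ : C} {d : V₁ ⟶ V₀} {d' : W₁ ⟶ W₀} (f₁ : V₁ ⟶ W₁) (f₀ : V₀ ⟶ W₀)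
    (h : d ≫ f₀ = f₁ ≫ d') : twoTerm d ⟶ twoTerm d' where
  f k := match k with
    | .ofNat 0 => f₀
    | .ofNat 1 => f₁
    | _ => 0
  comm' i j _ := by
    by_cases hij : i = 1 ∧ j = 0
    · obtain ⟨rfl, rfl⟩ := hij
      exact h.symm
    · rw [twoTerm_d_eq_zero d hij, twoTerm_d_eq_zero d' hij, zero_comp, comp_zero]

/-- The map `V_k ⟶ V₁ ⊕ V₀` which is the inclusion of the summand `V_k` for `k = 0, 1`. -/
def twoTermIncl {V₁ V₀ : C} (d : V₁ ⟶ V₀) : ∀ k : ℤ, (twoTerm d).X k ⟶ V₁ ⊞ V₀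
  | .ofNat 0 => (biprod.inr : V₀ ⟶ V₁ ⊞ V₀)
  | .ofNat 1 => (biprod.inl : V₁ ⟶ V₁ ⊞ V₀)
  | _ => 0

theorem twoTerm_inDegrees {V₁ V₀ : C} (d : V₁ ⟶ V₀) : InDegreesZeroOne (twoTerm d) := by
  intro k h0 h1
  match k, h0, h1 with
  | .ofNat 0, h0, _ => exact absurd rfl h0
  | .ofNat 1, _, h1 => exact absurd rfl h1
  | .ofNat (n + 2), _, _ => exact isZero_zero C
  | .negSucc n, _, _ => exact isZero_zero C

namespace PreXMod

variable [MonoidalCategory C] [SymmetricCategory C] {P : SymmOperad C}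

/-- The complex `V₁ ⟶ V₀` underlying a precrossed module. -/
abbrev cx (M : PreXMod P) : ChainComplex C ℤ := twoTerm M.d.hom

/-- The morphism of complexes underlying a morphism of precrossed modules. -/
abbrev cxMap {M N : PreXMod P} (φ : M ⟶ N) : M.cx ⟶ N.cx :=
  twoTermMap φ.top.hom φ.base.hom (congrArg Alg.Hom.hom φ.comm)

/-- The structure `s` of `P`-algebra on the complex `V₁ ⟶ V₀` is the one given by the algebra
structure of `V₀` in degree `0`, by the module structure of `V₁` over `V₀` (that is, the action
of `V₀` on `V₁`, on tensors with exactly one factor in `V₁`) in degree `1`, and by zero in higher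
degrees. -/
structure IsInduced (M : PreXMod P) (s : DGStr P M.cx) : Prop where
  degree_zero : ∀ n, s.op (fun _ : Fin n => 0) 0 (by simp) = M.base.op n
  degree_one : ∀ {n} (w : Fin n → ℤ) (h : ∑ i, w i = 1),
    s.op w 1 h = P.obj n ◁ tensMap (fun i => twoTermIncl M.d.hom (w i)) ≫ M.action.ρ n
  degree_ge_two : ∀ {n} (w : Fin n → ℤ) (k : ℤ) (h : ∑ i, w i = k), 2 ≤ k → s.op w k h = 0

/-- The differential graded algebra given by an algebra structure on the complex of a precrossed
module. -/
def toDG (M : PreXMod P) (s : DGStr P M.cx) : DGAlgLEOne P :=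
  ⟨⟨M.cx, s⟩, twoTerm_inDegrees M.d.hom⟩

end PreXMod

end TwoTerm

end

end OpdX

namespace OpdX

/-! An action of `V₀` on `V₁` makes the ungraded object `V₁ ⊕ V₀` an algebra, the semidirect
product, with operation `(ρ, μ)` (`semiOp`): the laws of `ρ` and of `V₀` are its two coordinates.
The operation on the complex (`cxOp`) is its restriction: include each `V_{wᵢ}` in `V₁ ⊕ V₀`, apply
`semiOp`, project to `V_k`. Naturality of the tensor constructions then carries equivariance and the
unit law over to the complex.

Associativity needs one more fact, because the inner operation is projected to a single degree
before the outer one is applied. In total degree at most one this projection loses nothing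
(`cxOp_incl`): `ρ` vanishes on `V₀`-arguments alone, and the `V₀`-coordinate vanishes as soon as one
argument is in `V₁`. Everything else is zero: a word with a letter other than `0` and `1` has a zero
source, and a degree other than `0` and `1` has a zero target. The vanishing of sources requires an
additive tensor product, which closedness provides. Koszul signs are trivial on the remaining words,
which have at most one odd letter.

The Leibniz rule has content only in total degrees one and two. In degree one it is equivariance of
`d` (`cxOp_d_one`). In degree two the left side is zero and the right side has two terms of opposite
sign, with `d` applied to one or the other of the two arguments in `V₁`; by the Peiffer identity
both are `ρ` of the arguments left as they are (`Peiffer.dAt_cxOp`), so they cancel. -/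

theorem naturality_eqToHom {C : Type u} [Category.{v} C] {ι : Type*} {F G : ι → C}
    (f : ∀ i, F i ⟶ G i) {i j : ι} (h : i = j) :
    f i ≫ eqToHom (congrArg G h) = eqToHom (congrArg F h) ≫ f j := by
  subst h; simp

/-! ### Naturality of the tensor product constructions. -/

section TensorNaturality

variable {C : Type u} [Category.{v} C] [MonoidalCategory C]

theorem tensSplit_naturality (a : ℕ) : (b : ℕ) → {F G : Fin (a + b) → C} → (f : ∀ i, F i ⟶ G i) →
    tensMap f ≫ (tensSplit a b G).hom = (tensSplit a b F).hom ≫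
      (tensMap (fun i => f (Fin.castAdd b i)) ⊗ₘ tensMap (fun j => f (Fin.natAdd a j)))
  | 0, F, G, f => by
      change tensMap f ≫ (ρ_ (tens G)).inv = (ρ_ (tens F)).inv ≫ (tensMap f ⊗ₘ 𝟙 (𝟙_ C))
      simp
  | b + 1, F, G, f => by
      have ih := tensSplit_naturality a b (fun i => f i.castSucc)
      change (tensMap (fun i : Fin (a + b) => f i.castSucc) ⊗ₘ f (Fin.last (a + b))) ≫
          (tensSplit a b (fun i => G i.castSucc)).hom ▷ G (Fin.last (a + b)) ≫ (α_ _ _ _).hom =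
        ((tensSplit a b (fun i => F i.castSucc)).hom ▷ F (Fin.last (a + b)) ≫ (α_ _ _ _).hom) ≫
          (tensMap (fun i => f (Fin.castAdd b i).castSucc) ⊗ₘ
            (tensMap (fun j => f (Fin.natAdd a j).castSucc) ⊗ₘ f (Fin.last (a + b))))
      rw [Category.assoc, ← associator_naturality, ← tensorHom_id, ← tensorHom_id,
        tensorHom_comp_tensorHom_assoc, tensorHom_comp_tensorHom_assoc, ih, Category.comp_id,
        Category.id_comp]

theorem tensSplit₃_naturality (a m b : ℕ) {F G : Fin (a + m + b) → C} (f : ∀ i, F i ⟶ G i) :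
    tensMap f ≫ (tensSplit₃ a m b G).hom = (tensSplit₃ a m b F).hom ≫
      ((tensMap (fun i => f (posL a m b i)) ⊗ₘ tensMap (fun i => f (posM a m b i))) ⊗ₘ
        tensMap (fun i => f (posR a m b i))) := by
  simp only [tensSplit₃, Iso.trans_hom, whiskerRightIso_hom, Category.assoc]
  rw [reassoc_of% (tensSplit_naturality (a + m) b f), ← tensorHom_id, ← tensorHom_id,
    tensorHom_comp_tensorHom, tensorHom_comp_tensorHom,
    tensSplit_naturality a m (fun i => f (Fin.castAdd b i)), Category.comp_id, Category.id_comp]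

theorem tensSplit₃_inv_naturality (a m b : ℕ) {F G : Fin (a + m + b) → C} (f : ∀ i, F i ⟶ G i) :
    (tensSplit₃ a m b F).inv ≫ tensMap f =
      ((tensMap (fun i => f (posL a m b i)) ⊗ₘ tensMap (fun i => f (posM a m b i))) ⊗ₘ
        tensMap (fun i => f (posR a m b i))) ≫ (tensSplit₃ a m b G).inv := by
  rw [Iso.inv_comp_eq, ← Category.assoc, Iso.eq_comp_inv, tensSplit₃_naturality]

variable [SymmetricCategory C]

/-- This is the rearrangement by which `tensExtract` carries the extracted factor past the last one;
it is the inductive step of `tensExtract_naturality`. -/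
theorem swap_last_naturality {A A' B B' D D' : C} (f : A ⟶ A') (g : B ⟶ B') (h : D ⟶ D') :
    ((f ⊗ₘ g) ⊗ₘ h) ≫ (α_ _ _ _).hom ≫ A' ◁ (β_ _ _).hom ≫ (α_ _ _ _).inv =
      (α_ _ _ _).hom ≫ A ◁ (β_ _ _).hom ≫ (α_ _ _ _).inv ≫ ((f ⊗ₘ h) ⊗ₘ g) := by
  rw [associator_naturality_assoc, ← associator_inv_naturality, ← id_tensorHom, ← id_tensorHom,
    tensorHom_comp_tensorHom_assoc, tensorHom_comp_tensorHom_assoc,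
    BraidedCategory.braiding_naturality, Category.comp_id, Category.id_comp]

/-- Between its block decompositions, `plug` only reassociates, braids `Q` past the left block and
applies a map to each block, so maps placed before it can be absorbed block by block. -/
theorem plug_core_naturality {Q A A' B B' D D' A₁ B₁ D₁ : C} (x : A ⟶ A') (y : B ⟶ B')
    (z : D ⟶ D') (l : A' ⟶ A₁) (f : Q ⊗ B' ⟶ B₁) (r : D' ⟶ D₁) :
    Q ◁ ((x ⊗ₘ y) ⊗ₘ z) ≫ (α_ _ _ _).inv ≫
        ((α_ _ _ _).inv ≫ (β_ _ _).hom ▷ _ ≫ (α_ _ _ _).hom ≫ (l ⊗ₘ f)) ▷ _ ≫ _ ◁ r =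
      (α_ _ _ _).inv ≫
        ((α_ _ _ _).inv ≫ (β_ _ _).hom ▷ _ ≫ (α_ _ _ _).hom ≫ ((x ≫ l) ⊗ₘ (Q ◁ y ≫ f))) ▷ _ ≫
        _ ◁ (z ≫ r) := by
  have h : Q ◁ (x ⊗ₘ y) ≫ (α_ _ _ _).inv ≫ (β_ _ _).hom ▷ _ ≫ (α_ _ _ _).hom =
      (α_ _ _ _).inv ≫ (β_ _ _).hom ▷ _ ≫ (α_ _ _ _).hom ≫ (x ⊗ₘ Q ◁ y) := by
    rw [← id_tensorHom, associator_inv_naturality_assoc, ← tensorHom_id, ← tensorHom_id,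
      tensorHom_comp_tensorHom_assoc, BraidedCategory.braiding_naturality, ← id_tensorHom,
      ← associator_naturality, tensorHom_comp_tensorHom_assoc, Category.comp_id,
      Category.id_comp]
  rw [← tensorHom_comp_tensorHom, ← reassoc_of% h, ← id_tensorHom Q ((x ⊗ₘ y) ⊗ₘ z),
    associator_inv_naturality_assoc, id_tensorHom, comp_whiskerRight (Q ◁ (x ⊗ₘ y)),
    Category.assoc]
  congr 1
  rw [MonoidalCategory.tensorHom_def, Category.assoc, MonoidalCategory.whiskerLeft_comp,
    whisker_exchange_assoc]

theorem tensExtract_naturality : {n : ℕ} → {F G : Fin (n + 1) → C} → (f : ∀ i, F i ⟶ G i) →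
    (i : Fin (n + 1)) →
    tensMap f ≫ tensExtract G i =
      tensExtract F i ≫ (tensMap (fun j => f (i.succAbove j)) ⊗ₘ f i)
  | 0, F, G, f, i => by
      change (𝟙 (𝟙_ C) ⊗ₘ f (Fin.last 0)) ≫ 𝟙_ C ◁ eqToHom _ =
        𝟙_ C ◁ eqToHom _ ≫ (𝟙 (𝟙_ C) ⊗ₘ f i)
      rw [id_tensorHom, id_tensorHom, ← whiskerLeft_comp, ← whiskerLeft_comp]
      congr 1
      exact naturality_eqToHom f (Subsingleton.elim (α := Fin 1) _ _)
  | n + 1, F, G, f, i => by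
      by_cases h : i = Fin.last (n + 1)
      · simp only [tensExtract, dif_pos h]
        rw [tensMap, tensorHom_comp_tensorHom, tensorHom_comp_tensorHom, ← tensMap_comp,
          ← tensMap_comp]
        congr 1
        · congr 1
          funext j
          exact naturality_eqToHom f (by rw [h, Fin.succAbove_last])
        · exact naturality_eqToHom f h.symm
      · have ih := tensExtract_naturality (fun j : Fin (n + 1) => f j.castSucc) (i.castPred h)
        have e : ∀ j : Fin n, ((i.castPred h).succAbove j).castSucc = i.succAbove j.castSucc :=
          fun j => by rw [← Fin.castSucc_succAbove_castSucc, Fin.castSucc_castPred]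
        have e' : (fun j : Fin n => eqToHom (congrArg F (e j)) ≫ f (i.succAbove j.castSucc)) =
            fun j => f ((i.castPred h).succAbove j).castSucc ≫ eqToHom (congrArg G (e j)) :=
          funext fun j => (naturality_eqToHom f (e j)).symm
        have e₁ : tensMap f = tensMap (fun j : Fin (n + 1) => f j.castSucc) ⊗ₘ f (Fin.last _) := rfl
        have e₂ : tensMap (fun j : Fin (n + 1) => f (i.succAbove j)) =
          tensMap (fun j : Fin n => f (i.succAbove j.castSucc)) ⊗ₘ
            f (i.succAbove (Fin.last n)) := rfl
        simp only [tensExtract, dif_neg h]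
        rw [e₁, e₂]
        simp only [Category.assoc, tensorHom_comp_tensorHom]
        rw [← tensMap_comp, ← naturality_eqToHom f (Fin.castSucc_castPred i h),
          ← naturality_eqToHom f (Fin.succAbove_ne_last_last h).symm, e', tensMap_comp,
          ← tensorHom_comp_tensorHom, ← tensorHom_comp_tensorHom,
          ← reassoc_of% @swap_last_naturality, ← tensorHom_id, tensorHom_comp_tensorHom_assoc, ih,
          ← tensorHom_id, tensorHom_comp_tensorHom_assoc, Category.comp_id, Category.id_comp]

theorem tensPerm_naturality : {n : ℕ} → (σ : Equiv.Perm (Fin n)) → {F G : Fin n → C} →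
    (f : ∀ i, F i ⟶ G i) →
    tensMap f ≫ tensPerm σ G = tensPerm σ F ≫ tensMap (fun i => f (σ i))
  | 0, _, _, _, _ => rfl
  | n + 1, σ, F, G, f => by
      have ih := tensPerm_naturality (residual σ)
        (fun j => f ((σ (Fin.last n)).succAbove j))
      have e : (fun j : Fin n => eqToHom (congrArg F (residual_spec σ j)) ≫ f (σ j.castSucc)) =
          fun j => f ((σ (Fin.last n)).succAbove (residual σ j)) ≫
            eqToHom (congrArg G (residual_spec σ j)) :=
        funext fun j => (naturality_eqToHom f (residual_spec σ j)).symm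
      simp only [tensPerm]
      rw [reassoc_of% (tensExtract_naturality f (σ (Fin.last n))), Category.assoc]
      congr 1
      rw [← tensorHom_id, ← tensorHom_id]
      change _ = _ ≫ (tensMap (fun j : Fin n => f (σ j.castSucc)) ⊗ₘ f (σ (Fin.last n)))
      rw [tensorHom_comp_tensorHom, tensorHom_comp_tensorHom, Category.comp_id, Category.id_comp,
        Category.assoc, ← tensMap_comp, e, tensMap_comp, reassoc_of% ih]

/-- Together with `plug_tensMap`, this moves inclusions and projections through a partial
composition, so that associativity can be compared on `V₁ ⊕ V₀`. -/
theorem whiskerLeft_tensMap_plug (a m b : ℕ) {F F' : Fin (a + m + b) → C}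
    {G : Fin (a + 1 + b) → C} {Q : C} (g : ∀ i, F i ⟶ F' i)
    (l : ∀ i, F' (posL a m b i) ⟶ G (posL a 1 b i))
    (f : Q ⊗ tens (fun i => F' (posM a m b i)) ⟶ G (posM a 1 b 0))
    (r : ∀ i, F' (posR a m b i) ⟶ G (posR a 1 b i)) :
    Q ◁ tensMap g ≫ plug a m b l f r =
      plug a m b (fun i => g (posL a m b i) ≫ l i)
        (Q ◁ tensMap (fun i => g (posM a m b i)) ≫ f)
        (fun i => g (posR a m b i) ≫ r i) := by
  simp only [plug]
  rw [← whiskerLeft_comp_assoc, tensSplit₃_naturality, tensMap_comp, tensMap_comp]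
  rw [MonoidalCategory.whiskerLeft_comp, Category.assoc, reassoc_of% @plug_core_naturality,
    Category.assoc]

theorem plug_tensMap (a m b : ℕ) {F : Fin (a + m + b) → C}
    {G G' : Fin (a + 1 + b) → C} {Q : C}
    (l : ∀ i, F (posL a m b i) ⟶ G (posL a 1 b i))
    (f : Q ⊗ tens (fun i => F (posM a m b i)) ⟶ G (posM a 1 b 0))
    (r : ∀ i, F (posR a m b i) ⟶ G (posR a 1 b i)) (g : ∀ i, G i ⟶ G' i) :
    plug a m b l f r ≫ tensMap g =
      plug a m b (fun i => l i ≫ g (posL a 1 b i)) (f ≫ g (posM a 1 b 0))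
        (fun i => r i ≫ g (posR a 1 b i)) := by
  simp only [plug, Category.assoc]
  rw [tensSplit₃_inv_naturality, tensMap_comp, tensMap_comp]
  have e : (tensMap fun i => g (posM a 1 b i)) = 𝟙 (𝟙_ C) ⊗ₘ g (posM a 1 b 0) := rfl
  rw [e]
  have h : (λ_ (G (posM a 1 b 0))).inv ≫ (𝟙 (𝟙_ C) ⊗ₘ g (posM a 1 b 0)) =
      g (posM a 1 b 0) ≫ (λ_ _).inv := by
    rw [id_tensorHom, leftUnitor_inv_naturality]
  rw [← MonoidalCategory.tensorHom_def_assoc, ← MonoidalCategory.tensorHom_def_assoc,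
    tensorHom_comp_tensorHom_assoc]
  simp only [Category.assoc, tensorHom_comp_tensorHom, h]

end TensorNaturality

/-! ### Additivity of the tensor product. -/

section Additive

variable {C : Type u} [Category.{v} C] [Abelian C] [MonoidalCategory C]

/-- Tensoring on the left has a right adjoint, hence preserves binary coproducts, which are
biproducts here, and is therefore additive; the braiding gives the other side. -/
theorem monoidalPreadditive_of_closed [SymmetricCategory C] [MonoidalClosed C] :
    MonoidalPreadditive C := by
  have hl (X : C) : (tensorLeft X).Additive := by
    have : PreservesColimitsOfSize.{0, 0} (tensorLeft X) :=
      (ihom.adjunction X).leftAdjoint_preservesColimits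
    have := preservesBinaryBiproducts_of_preservesBinaryCoproducts (tensorLeft X)
    exact Functor.additive_of_preservesBinaryBiproducts _
  have hr (X : C) : (tensorRight X).Additive :=
    Functor.additive_of_iso (BraidedCategory.tensorLeftIsoTensorRight X)
  exact
    { whiskerLeft_zero := fun {X _ _} => (tensorLeft X).map_zero _ _
      zero_whiskerRight := fun {X _ _} => (tensorRight X).map_zero _ _
      whiskerLeft_add := fun {X _ _} _ _ => (tensorLeft X).map_add
      add_whiskerRight := fun {X _ _} _ _ => (tensorRight X).map_add }

theorem tensMap_eq_zero [MonoidalPreadditive C] : {n : ℕ} → {F G : Fin n → C} →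
    (f : ∀ i, F i ⟶ G i) → (i : Fin n) → f i = 0 → tensMap f = 0
  | 0, _, _, _, i, _ => i.elim0
  | n + 1, _, _, f, i, h => by
      rw [tensMap]
      induction i using Fin.lastCases with
      | last => rw [h, MonoidalPreadditive.tensor_zero]
      | cast i => rw [tensMap_eq_zero (fun i : Fin n => f i.castSucc) i h,
          MonoidalPreadditive.zero_tensor]

theorem isZero_tens [MonoidalPreadditive C] {n : ℕ} {F : Fin n → C} (i : Fin n)
    (h : IsZero (F i)) : IsZero (tens F) := by
  rw [IsZero.iff_id_eq_zero, ← tensMap_id]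
  exact tensMap_eq_zero _ i (h.eq_of_src _ _)

theorem isZero_tensor [MonoidalPreadditive C] (Q : C) {X : C} (h : IsZero X) : IsZero (Q ⊗ X) := by
  rw [IsZero.iff_id_eq_zero] at h ⊢
  rw [← whiskerLeft_id, h, MonoidalPreadditive.whiskerLeft_zero]

end Additive

noncomputable section

/-! ### Permutations, and words in the degrees `0` and `1`. -/

theorem exists_perm_pair {n : ℕ} {a b p q : Fin n} (hab : a ≠ b) (hpq : p ≠ q) :
    ∃ σ : Equiv.Perm (Fin n), σ a = p ∧ σ b = q := by
  -- After `a` is sent to `p`, the second swap sends the image of `b` to `q`; it fixes `p`, which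
  -- differs from both.
  refine ⟨(Equiv.swap a p).trans (Equiv.swap (Equiv.swap a p b) q), ?_, by simp⟩
  rw [Equiv.trans_apply, Equiv.swap_apply_left, Equiv.swap_apply_of_ne_of_ne _ hpq]
  intro h
  rw [← Equiv.swap_apply_left a p] at h
  exact hab ((Equiv.swap a _).injective (by simpa using h))

theorem SymmOperad.isIso_act {C : Type u} [Category.{v} C] [MonoidalCategory C]
    [SymmetricCategory C] (P : SymmOperad C) {n : ℕ} (σ : Equiv.Perm (Fin n)) : IsIso (P.act σ) :=
  ⟨P.act σ.symm, by rw [← P.act_trans, Equiv.self_trans_symm, P.act_refl],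
    by rw [← P.act_trans, Equiv.symm_trans_self, P.act_refl]⟩

section Words

/-- A word in the letters `0` and `1`. -/
def IsBinary {n : ℕ} (w : Fin n → ℤ) : Prop := ∀ i, w i = 0 ∨ w i = 1

variable {n : ℕ} {w : Fin n → ℤ}

theorem IsBinary.nonneg (hw : IsBinary w) (i : Fin n) : 0 ≤ w i := by
  rcases hw i with h | h <;> omega

theorem IsBinary.add_le_sum (hw : IsBinary w) {i j : Fin n} (hij : i ≠ j) :
    w i + w j ≤ ∑ l, w l := by
  rw [← Finset.sum_pair hij]
  exact Finset.sum_le_sum_of_subset_of_nonneg (Finset.subset_univ _) fun l _ _ => hw.nonneg l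

theorem IsBinary.eq_zero_of_sum (hw : IsBinary w) (h : ∑ i, w i = 0) (i : Fin n) : w i = 0 :=
  (Finset.sum_eq_zero_iff_of_nonneg fun i _ => hw.nonneg i).1 h i (Finset.mem_univ i)

theorem IsBinary.exists_of_sum_pos (hw : IsBinary w) (h : 0 < ∑ i, w i) : ∃ i, w i = 1 := by
  by_contra! hne
  rw [Finset.sum_eq_zero fun i _ => (hw i).resolve_right (hne i)] at h
  exact h.false

theorem IsBinary.exists_of_sum_eq_one (hw : IsBinary w) (h : ∑ i, w i = 1) :
    ∃ i, w i = 1 ∧ ∀ j, j ≠ i → w j = 0 := by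
  obtain ⟨i, hi⟩ := hw.exists_of_sum_pos (by omega)
  refine ⟨i, hi, fun j hj => (hw j).resolve_right fun hj' => ?_⟩
  have := hw.add_le_sum hj
  omega

theorem IsBinary.exists_of_sum_eq_two (hw : IsBinary w) (h : ∑ i, w i = 2) :
    ∃ p q, p < q ∧ w p = 1 ∧ w q = 1 ∧ ∀ j, j ≠ p → j ≠ q → w j = 0 := by
  obtain ⟨p, hp⟩ := hw.exists_of_sum_pos (by omega)
  have hb : IsBinary (lower w p) := fun j => by
    by_cases hj : j = p
    · subst hj; simp [lower, hp]
    · simpa [lower, hj] using hw j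
  -- Lowering one letter `1` leaves a binary word of sum one, whose only nonzero letter is the
  -- second position.
  obtain ⟨q, hq, hj⟩ := hb.exists_of_sum_eq_one (by rw [sum_lower, h]; rfl)
  have hqp : q ≠ p := by
    rintro rfl
    simp [lower, hp] at hq
  have hq' : w q = 1 := by simpa [lower, hqp] using hq
  have hj' : ∀ j, j ≠ p → j ≠ q → w j = 0 := fun j h₁ h₂ => by
    simpa [lower, h₁] using hj j h₂
  rcases lt_or_gt_of_ne hqp with hlt | hlt
  · exact ⟨q, p, hlt, hq', hp, fun j h₁ h₂ => hj' j h₂ h₁⟩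
  · exact ⟨p, q, hlt, hp, hq', hj'⟩

/-- At most one letter is nonzero, so every product of two letters at distinct positions vanishes.
-/
theorem IsBinary.koszulSign_eq_one (hw : IsBinary w) (h : ∑ i, w i ≤ 1)
    (σ : Equiv.Perm (Fin n)) : koszulSign σ w = 1 := by
  refine Finset.prod_eq_one fun i _ => Finset.prod_eq_one fun j _ => ?_
  split_ifs with hij
  · have hs := hw.add_le_sum (fun e => hij.2.ne e.symm : σ i ≠ σ j)
    have h0 : w (σ i) * w (σ j) = 0 := by
      rcases hw (σ i) with h₁ | h₁ <;> rcases hw (σ j) with h₂ | h₂ <;> simp [h₁, h₂]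
      omega
    rw [h0, Int.negOnePow_zero]
  · rfl

end Words

/-! ### Inclusions and projections between the two-term complex and `V₁ ⊕ V₀`. -/

section TwoTermMaps

variable {C : Type u} [Category.{v} C] [Abelian C] {V₁ V₀ : C} (d : V₁ ⟶ V₀)

/-- The map `V₁ ⊕ V₀ ⟶ V_k` which is the projection to the summand `V_k` for `k = 0, 1`. -/
def twoTermProj : ∀ k : ℤ, V₁ ⊞ V₀ ⟶ (twoTerm d).X k
  | .ofNat 0 => (biprod.snd : V₁ ⊞ V₀ ⟶ V₀)
  | .ofNat 1 => (biprod.fst : V₁ ⊞ V₀ ⟶ V₁)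
  | _ => 0

theorem twoTermIncl_proj : ∀ k : ℤ, twoTermIncl d k ≫ twoTermProj d k = 𝟙 ((twoTerm d).X k)
  | .ofNat 0 => biprod.inr_snd
  | .ofNat 1 => biprod.inl_fst
  | .ofNat (_ + 2) => (isZero_zero C).eq_of_src _ _
  | .negSucc _ => (isZero_zero C).eq_of_src _ _

theorem twoTermIncl_fst {k : ℤ} (h : k ≠ 1) :
    twoTermIncl d k ≫ (biprod.fst : V₁ ⊞ V₀ ⟶ V₁) = 0 :=
  match k with
  | .ofNat 0 => biprod.inr_fst
  | .ofNat 1 => absurd rfl h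
  | .ofNat (_ + 2) => zero_comp
  | .negSucc _ => zero_comp

theorem twoTermIncl_snd {k : ℤ} (h : k ≠ 0) :
    twoTermIncl d k ≫ (biprod.snd : V₁ ⊞ V₀ ⟶ V₀) = 0 :=
  match k with
  | .ofNat 0 => absurd rfl h
  | .ofNat 1 => biprod.inl_snd
  | .ofNat (_ + 2) => zero_comp
  | .negSucc _ => zero_comp

theorem twoTermProj_incl_zero :
    twoTermProj d 0 ≫ twoTermIncl d 0 = (biprod.snd : V₁ ⊞ V₀ ⟶ V₀) ≫ biprod.inr := rfl

theorem twoTermProj_incl_one :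
    twoTermProj d 1 ≫ twoTermIncl d 1 = (biprod.fst : V₁ ⊞ V₀ ⟶ V₁) ≫ biprod.inl := rfl

/-- `twoTermProj d 0` is `biprod.snd` only after unfolding the complex. Exposing a `biprod.snd` in
front of it lets rules such as `semiOp_snd` apply; `fst_inl_twoTermProj_one` does the same for
`biprod.fst`. -/
theorem snd_inr_twoTermProj_zero :
    (biprod.snd : V₁ ⊞ V₀ ⟶ V₀) ≫ biprod.inr ≫ twoTermProj d 0 = twoTermProj d 0 :=
  (congrArg (biprod.snd ≫ ·) biprod.inr_snd).trans (Category.comp_id _)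

theorem fst_inl_twoTermProj_one :
    (biprod.fst : V₁ ⊞ V₀ ⟶ V₁) ≫ biprod.inl ≫ twoTermProj d 1 = twoTermProj d 1 :=
  (congrArg (biprod.fst ≫ ·) biprod.inl_fst).trans (Category.comp_id _)

theorem twoTermProj_d : twoTermProj d 1 ≫ (twoTerm d).d 1 0 =
    (biprod.fst : V₁ ⊞ V₀ ⟶ V₁) ≫ d ≫ biprod.inr ≫ twoTermProj d 0 :=
  (congrArg (fun f => biprod.fst ≫ d ≫ f) (biprod.inr_snd : _ = 𝟙 V₀)).trans
    (congrArg (biprod.fst ≫ ·) (Category.comp_id d)) |>.symm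

theorem eqToHom_twoTermIncl {k l : ℤ} (h : k = l) :
    eqToHom (congrArg (twoTerm d).X h) ≫ twoTermIncl d l = twoTermIncl d k := by
  subst h; simp

theorem d_twoTermIncl {k l : ℤ} (hk : k = 1) (hl : l = 0) :
    (twoTerm d).d k l ≫ twoTermIncl d l =
      twoTermIncl d k ≫ (biprod.fst : V₁ ⊞ V₀ ⟶ V₁) ≫ d ≫ biprod.inr := by
  subst hk hl
  exact (biprod.inl_fst_assoc _).symm

variable {d} {W₁ W₀ : C} {d' : W₁ ⟶ W₀} (f₁ : V₁ ⟶ W₁) (f₀ : V₀ ⟶ W₀) (h : d ≫ f₀ = f₁ ≫ d')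

theorem twoTermMap_incl : ∀ k : ℤ, (twoTermMap f₁ f₀ h).f k ≫ twoTermIncl d' k =
    twoTermIncl d k ≫ biprod.map f₁ f₀
  | .ofNat 0 => (biprod.inr_map f₁ f₀).symm
  | .ofNat 1 => (biprod.inl_map f₁ f₀).symm
  | .ofNat (_ + 2) => (isZero_zero C).eq_of_src _ _
  | .negSucc _ => (isZero_zero C).eq_of_src _ _

theorem twoTermProj_map : ∀ k : ℤ, twoTermProj d k ≫ (twoTermMap f₁ f₀ h).f k =
    biprod.map f₁ f₀ ≫ twoTermProj d' k
  | .ofNat 0 => (biprod.map_snd f₁ f₀).symm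
  | .ofNat 1 => (biprod.map_fst f₁ f₀).symm
  | .ofNat (_ + 2) => (isZero_zero C).eq_of_tgt _ _
  | .negSucc _ => (isZero_zero C).eq_of_tgt _ _

end TwoTermMaps

/-! ### The differential on one tensor factor. -/

section DAt

variable {C : Type u} [Category.{v} C] [Abelian C] [MonoidalCategory C] {V₁ V₀ : C} (d : V₁ ⟶ V₀)

/-- Inside `V₁ ⊕ V₀` the differential becomes an endomorphism of the `i`-th factor, and the
transports between `w` and `lower w i` disappear. -/
theorem dAt_tensMap_twoTermIncl {n : ℕ} {w : Fin n → ℤ} {i : Fin n} (hi : w i = 1) :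
    dAt (twoTerm d) w i ≫ tensMap (fun j => twoTermIncl d (lower w i j)) =
      tensMap (fun j => twoTermIncl d (w j) ≫
        if j = i then (biprod.fst : V₁ ⊞ V₀ ⟶ V₁) ≫ d ≫ biprod.inr else 𝟙 _) := by
  rw [dAt, ← tensMap_comp]
  congr 1
  funext j
  split_ifs with hj
  · subst hj
    exact d_twoTermIncl d hi (by simp [lower, hi])
  · rw [Category.comp_id]
    exact eqToHom_twoTermIncl d (by simp [lower, hj])

theorem dAt_twoTerm_eq_zero [MonoidalPreadditive C] {n : ℕ} {w : Fin n → ℤ} {i : Fin n}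
    (hi : w i ≠ 1) : dAt (twoTerm d) w i = 0 := by
  refine tensMap_eq_zero _ i ?_
  rw [dif_pos rfl]
  exact twoTerm_d_eq_zero d fun h => hi h.1

theorem isZero_tens_twoTerm [MonoidalPreadditive C] {n : ℕ} {w : Fin n → ℤ} (hw : ¬ IsBinary w) :
    IsZero (tens fun i => (twoTerm d).X (w i)) := by
  simp only [IsBinary, not_forall, not_or] at hw
  obtain ⟨i, h0, h1⟩ := hw
  exact isZero_tens i (twoTerm_inDegrees d (w i) h0 h1)

end DAt

/-! ### The semidirect product algebra and the operations it induces on the complex. -/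

namespace PreXMod

variable {C : Type u} [Category.{v} C] [Abelian C] [MonoidalCategory C] [SymmetricCategory C]
variable {P : SymmOperad C} (M : PreXMod P)

/-- The structure morphisms of the semidirect product `V₁ ⊕ V₀`. -/
abbrev semiOp (n : ℕ) :
    P.obj n ⊗ tpow (M.top.X ⊞ M.base.X) n ⟶ M.top.X ⊞ M.base.X :=
  extendOp M.base (M.action.ρ n)

theorem semiOp_fst (n : ℕ) : M.semiOp n ≫ biprod.fst = M.action.ρ n := biprod.lift_fst _ _

theorem semiOp_snd (n : ℕ) : M.semiOp n ≫ biprod.snd =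
    P.obj n ◁ tensMap (fun _ => biprod.snd) ≫ M.base.op n := biprod.lift_snd _ _

theorem semiOp_act {n : ℕ} (σ : Equiv.Perm (Fin n)) :
    P.act σ ▷ tpow (M.top.X ⊞ M.base.X) n ≫ M.semiOp n =
      P.obj n ◁ tensPerm σ (fun _ => M.top.X ⊞ M.base.X) ≫ M.semiOp n := by
  apply biprod.hom_ext
  · simp only [Category.assoc, semiOp_fst, M.action.ρ_act]
  · simp only [Category.assoc, semiOp_snd]
    rw [← whisker_exchange_assoc, M.base.op_act, ← whiskerLeft_comp_assoc,
      ← whiskerLeft_comp_assoc, tensPerm_naturality]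

/-- The first coordinate is `ρ_comp`, whose inner operation is already `(ρ, μ)`; the second is
associativity in `V₀`, pulled back along the projection. -/
theorem semiOp_comp (a b m : ℕ) :
    P.comp a b m ▷ tpow (M.top.X ⊞ M.base.X) (a + m + b) ≫ M.semiOp (a + m + b) =
      (α_ _ _ _).hom ≫ P.obj (a + 1 + b) ◁ plug a m b (fun _ => 𝟙 _) (M.semiOp m) (fun _ => 𝟙 _) ≫
        M.semiOp (a + 1 + b) := by
  apply biprod.hom_ext
  · simp only [Category.assoc, semiOp_fst, M.action.ρ_comp]
  · simp only [Category.assoc, semiOp_snd]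
    rw [← whisker_exchange_assoc, M.base.op_comp, ← whiskerLeft_comp_assoc, plug_tensMap,
      semiOp_snd, tensor_whiskerLeft, Category.assoc, Category.assoc, Iso.inv_hom_id_assoc,
      ← whiskerLeft_comp_assoc, whiskerLeft_tensMap_plug]
    simp only [Category.id_comp, Category.comp_id]

/-- The unit law is not an axiom of actions: on `V₁` it follows from `ρ_compat` and the unit law of
that algebra, on `V₀` from `ρ_base`. -/
theorem unit_ρ : P.unit ▷ tpow (M.top.X ⊞ M.base.X) 1 ≫ M.action.ρ 1 =
    (λ_ _).hom ≫ (λ_ _).hom ≫ biprod.fst := by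
  -- With the unitors moved across, the source is the biproduct itself, so equality can be tested on
  -- its summands.
  rw [← Iso.inv_comp_eq, ← Iso.inv_comp_eq]
  have key {Y : C} (f : Y ⟶ M.top.X ⊞ M.base.X) :
      f ≫ (λ_ _).inv ≫ (λ_ _).inv ≫ P.unit ▷ tpow (M.top.X ⊞ M.base.X) 1 ≫ M.action.ρ 1 =
        (λ_ _).inv ≫ (λ_ _).inv ≫ P.unit ▷ tpow Y 1 ≫
          P.obj 1 ◁ tensMap (fun _ : Fin 1 => f) ≫ M.action.ρ 1 := by
    have e : tensMap (fun _ : Fin 1 => f) = 𝟙_ C ◁ f := id_tensorHom _ _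
    rw [e, ← whisker_exchange_assoc, leftUnitor_inv_naturality_assoc,
      leftUnitor_inv_naturality_assoc]
  apply biprod.hom_ext'
  · rw [key, M.action.ρ_compat, M.top.op_unit]
    simp
  · rw [key, M.action.ρ_base]
    simp

theorem semiOp_unit : P.unit ▷ tpow (M.top.X ⊞ M.base.X) 1 ≫ M.semiOp 1 =
    (λ_ _).hom ≫ (λ_ _).hom := by
  apply biprod.hom_ext
  · simp only [Category.assoc, semiOp_fst]
    exact M.unit_ρ
  · have e : tensMap (fun _ : Fin 1 => (biprod.snd : M.top.X ⊞ M.base.X ⟶ _)) =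
      𝟙_ C ◁ biprod.snd := id_tensorHom _ _
    simp only [Category.assoc, semiOp_snd]
    rw [← whisker_exchange_assoc, M.base.op_unit, e]
    simp

/-- The components of the structure morphisms of the complex of a precrossed module. -/
def cxOp {n : ℕ} (w : Fin n → ℤ) (k : ℤ) :
    P.obj n ⊗ tens (fun i => M.cx.X (w i)) ⟶ M.cx.X k :=
  P.obj n ◁ tensMap (fun i => twoTermIncl M.d.hom (w i)) ≫ M.semiOp n ≫ twoTermProj M.d.hom k

theorem cxOp_one {n : ℕ} (w : Fin n → ℤ) :
    M.cxOp w 1 = P.obj n ◁ tensMap (fun i => twoTermIncl M.d.hom (w i)) ≫ M.action.ρ n :=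
  congrArg (_ ≫ ·) (M.semiOp_fst n)

theorem cxOp_zero {n : ℕ} (w : Fin n → ℤ) :
    M.cxOp w 0 = P.obj n ◁ tensMap (fun i => twoTermIncl M.d.hom (w i) ≫ biprod.snd) ≫
      M.base.op n := by
  rw [tensMap_comp, MonoidalCategory.whiskerLeft_comp, Category.assoc]
  exact congrArg (_ ≫ ·) (M.semiOp_snd n)

theorem cxOp_const_zero (n : ℕ) : M.cxOp (fun _ : Fin n => 0) 0 = M.base.op n := by
  have e : (fun _ : Fin n => twoTermIncl M.d.hom 0 ≫ (biprod.snd : M.top.X ⊞ M.base.X ⟶ _)) =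
      fun _ : Fin n => 𝟙 M.base.X := funext fun _ => biprod.inr_snd
  rw [cxOp_zero, e]
  refine (congrArg (P.obj n ◁ · ≫ M.base.op n) (tensMap_id (fun _ : Fin n => M.base.X))).trans ?_
  simp

theorem cxOp_act {n : ℕ} (σ : Equiv.Perm (Fin n)) (w : Fin n → ℤ) (k : ℤ) :
    P.act σ ▷ tens (fun i => M.cx.X (w i)) ≫ M.cxOp w k =
      P.obj n ◁ tensPerm σ (fun i => M.cx.X (w i)) ≫ M.cxOp (fun i => w (σ i)) k := by
  rw [cxOp, cxOp, ← whisker_exchange_assoc, reassoc_of% M.semiOp_act, ← whiskerLeft_comp_assoc,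
    ← whiskerLeft_comp_assoc, tensPerm_naturality]

theorem cxOp_unit (w : Fin 1 → ℤ) (k : ℤ) (h : w 0 = k) :
    P.unit ▷ tens (fun i => M.cx.X (w i)) ≫ M.cxOp w k =
      (λ_ _).hom ≫ (λ_ (M.cx.X (w 0))).hom ≫ eqToHom (congrArg M.cx.X h) := by
  subst h
  have e : tensMap (fun i : Fin 1 => twoTermIncl M.d.hom (w i)) =
      𝟙_ C ◁ twoTermIncl M.d.hom (w 0) := id_tensorHom _ _
  rw [cxOp, ← whisker_exchange_assoc, reassoc_of% M.semiOp_unit, leftUnitor_naturality_assoc, e,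
    leftUnitor_naturality_assoc, twoTermIncl_proj]
  rfl

theorem ρ_tensMap_perm {n : ℕ} {F : Fin n → C} (g : ∀ i, F i ⟶ M.top.X ⊞ M.base.X)
    (σ : Equiv.Perm (Fin n)) :
    P.act σ ▷ tens F ≫ P.obj n ◁ tensMap g ≫ M.action.ρ n =
      P.obj n ◁ tensPerm σ F ≫ P.obj n ◁ tensMap (fun i => g (σ i)) ≫ M.action.ρ n := by
  rw [← whisker_exchange_assoc, M.action.ρ_act, ← whiskerLeft_comp_assoc,
    ← whiskerLeft_comp_assoc, tensPerm_naturality]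

/-! ### The Peiffer identity in arbitrary positions. -/

section Peiffer

variable {M}

/-- The Peiffer identity for two arguments in `V₁`, in adjacent initial positions. -/
theorem Peiffer.ρ_eq_initial (hM : M.Peiffer) {r : ℕ} {F : Fin (1 + 1 + r) → C}
    (g g' : ∀ i, F i ⟶ M.top.X ⊞ M.base.X)
    (hp : g (posL 1 1 r 0) ≫ biprod.snd = 0) (hq : g (posM 1 1 r 0) ≫ biprod.snd = 0)
    (hr : ∀ j, g (posR 1 1 r j) ≫ biprod.fst = 0)
    (hg : g' (posM 1 1 r 0) = g (posM 1 1 r 0) ≫ biprod.fst ≫ M.d.hom ≫ biprod.inr)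
    (hg' : ∀ j, j ≠ posM 1 1 r 0 → g' j = g j) :
    P.obj _ ◁ tensMap g ≫ M.action.ρ _ = P.obj _ ◁ tensMap g' ≫ M.action.ρ _ := by
  have fac {Y : C} (f : Y ⟶ M.top.X ⊞ M.base.X) (h : f ≫ biprod.snd = 0) :
      f = (f ≫ biprod.fst) ≫ biprod.inl := by
    apply biprod.hom_ext <;> simp [h]
  have fac' {Y : C} (f : Y ⟶ M.top.X ⊞ M.base.X) (h : f ≫ biprod.fst = 0) :
      f = (f ≫ biprod.snd) ≫ biprod.inr := by
    apply biprod.hom_ext <;> simp [h]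
  have hL : tensMap (fun i => g (posL 1 1 r i)) =
      tensMap (fun i => g (posL 1 1 r i) ≫ biprod.fst) ≫ tensMap (fun _ => biprod.inl) := by
    rw [← tensMap_comp]
    exact congrArg tensMap (funext fun i => fac _ (by rwa [Subsingleton.elim i 0]))
  have hMid : tensMap (fun i => g (posM 1 1 r i)) =
      tensMap (fun i => g (posM 1 1 r i) ≫ biprod.fst) ≫ tensMap (fun _ => biprod.inl) := by
    rw [← tensMap_comp]
    exact congrArg tensMap (funext fun i => fac _ (by rwa [Subsingleton.elim i 0]))
  have hR : tensMap (fun i => g (posR 1 1 r i)) =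
      tensMap (fun i => g (posR 1 1 r i) ≫ biprod.snd) ≫ tensMap (fun _ => biprod.inr) := by
    rw [← tensMap_comp]
    exact congrArg tensMap (funext fun i => fac' _ (hr i))
  have hL' : (fun i => g' (posL 1 1 r i)) = fun i => g (posL 1 1 r i) :=
    funext fun i => hg' _ (by simp [Fin.ext_iff])
  have hMid' : tensMap (fun i => g' (posM 1 1 r i)) =
      tensMap (fun i => g (posM 1 1 r i) ≫ biprod.fst) ≫
        tensMap (fun _ => M.d.hom ≫ biprod.inr) := by
    rw [← tensMap_comp]
    exact congrArg tensMap (funext fun i => by rw [Subsingleton.elim i 0, hg, Category.assoc])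
  have hR' : (fun i => g' (posR 1 1 r i)) = fun i => g (posR 1 1 r i) :=
    funext fun i => hg' _ (by simp [Fin.ext_iff]; omega)
  -- Two arguments in `V₁`: the second one receives `d`. No other case of the identity is needed.
  have key := hM 1 r
  rw [← Iso.hom_inv_id_assoc (tensSplit₃ 1 1 r F) (tensMap g),
    ← Iso.hom_inv_id_assoc (tensSplit₃ 1 1 r F) (tensMap g'), tensSplit₃_inv_naturality,
    tensSplit₃_inv_naturality, hL', hMid', hR', hL, hMid, hR]
  simp only [← tensorHom_comp_tensorHom, MonoidalCategory.whiskerLeft_comp,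
    Category.assoc] at key ⊢
  rw [key]

/-- The Peiffer identity for two arguments in `V₁`, in arbitrary positions. -/
theorem Peiffer.ρ_eq (hM : M.Peiffer) {n : ℕ} {F : Fin n → C}
    (g g' : ∀ i, F i ⟶ M.top.X ⊞ M.base.X) {p q : Fin n} (hpq : p ≠ q)
    (hp : g p ≫ biprod.snd = 0) (hq : g q ≫ biprod.snd = 0)
    (hr : ∀ j, j ≠ p → j ≠ q → g j ≫ biprod.fst = 0)
    (hg : g' q = g q ≫ biprod.fst ≫ M.d.hom ≫ biprod.inr)
    (hg' : ∀ j, j ≠ q → g' j = g j) :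
    P.obj n ◁ tensMap g ≫ M.action.ρ n = P.obj n ◁ tensMap g' ≫ M.action.ρ n := by
  obtain ⟨r, rfl⟩ : ∃ r, n = 1 + 1 + r := ⟨n - 2, by omega⟩
  -- Relabelling by `σ` brings `p` and `q` to the first two places; `P.act σ` is invertible, so
  -- nothing is lost by composing with it.
  obtain ⟨σ, rfl, rfl⟩ := exists_perm_pair
    (a := posL 1 1 r 0) (b := posM 1 1 r 0) (by simp [Fin.ext_iff]) hpq
  have := P.isIso_act σ
  rw [← cancel_epi (P.act σ ▷ tens F), M.ρ_tensMap_perm, M.ρ_tensMap_perm,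
    hM.ρ_eq_initial (fun i => g (σ i)) (fun i => g' (σ i)) hp hq
      (fun j => hr _ (fun h => ?_) fun h => ?_) hg
      fun j hj => hg' _ fun h => hj (σ.injective h)]
  · have := σ.injective h
    simp [Fin.ext_iff] at this
  · have := σ.injective h
    simp [Fin.ext_iff] at this
    omega

/-- The right side does not depend on which of the two arguments in `V₁` is differentiated, so
exchanging `p` and `q` shows that both choices give the same result. -/
theorem Peiffer.dAt_cxOp (hM : M.Peiffer) {n : ℕ} {w : Fin n → ℤ} {p q : Fin n} (hpq : p ≠ q)
    (hp : w p = 1) (hq : w q = 1) (h0 : ∀ j, j ≠ p → j ≠ q → w j = 0) :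
    P.obj n ◁ dAt M.cx w q ≫ M.cxOp (lower w q) 1 =
      P.obj n ◁ tensMap (fun i => twoTermIncl M.d.hom (w i)) ≫ M.action.ρ n ≫
        biprod.inl ≫ twoTermProj M.d.hom 1 := by
  rw [cxOp, ← whiskerLeft_comp_assoc, dAt_tensMap_twoTermIncl M.d.hom hq,
    ← fst_inl_twoTermProj_one, reassoc_of% M.semiOp_fst, biprod.inl_fst_assoc,
    ← Category.assoc, ← Category.assoc _ (M.action.ρ n)]
  congr 1
  refine (hM.ρ_eq _ _ hpq (twoTermIncl_snd _ (by omega)) (twoTermIncl_snd _ (by omega))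
    (fun j h₁ h₂ => twoTermIncl_fst _ (by rw [h0 j h₁ h₂]; omega)) ?_ fun j hj => ?_).symm
  · rw [if_pos rfl]
  · rw [if_neg hj, Category.comp_id]

end Peiffer

/-! ### The axioms of a differential graded algebra, and uniqueness. -/

section Preadditive

variable [MonoidalPreadditive C]

theorem isZero_source {n : ℕ} {w : Fin n → ℤ} (hw : ¬ IsBinary w) (Q : C) :
    IsZero (Q ⊗ tens (fun i => M.cx.X (w i))) :=
  isZero_tensor Q (isZero_tens_twoTerm M.d.hom hw)

/-- In degrees `0` and `1`, the semidirect product structure preserves degrees. -/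
theorem cxOp_incl {n : ℕ} {w : Fin n → ℤ} (hw : IsBinary w) (h : ∑ i, w i ≤ 1) :
    M.cxOp w (∑ i, w i) ≫ twoTermIncl M.d.hom (∑ i, w i) =
      P.obj n ◁ tensMap (fun i => twoTermIncl M.d.hom (w i)) ≫ M.semiOp n := by
  have h0 : 0 ≤ ∑ i, w i := Finset.sum_nonneg fun i _ => hw.nonneg i
  obtain h | h : ∑ i, w i = 0 ∨ ∑ i, w i = 1 := by omega
  · obtain rfl : w = fun _ => 0 := funext (hw.eq_zero_of_sum h)
    rw [h, cxOp, Category.assoc, Category.assoc, twoTermProj_incl_zero]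
    apply biprod.hom_ext
    · simp only [Category.assoc, biprod.inr_fst, comp_zero, semiOp_fst]
      exact (M.action.ρ_base n).symm
    · simp only [Category.assoc, biprod.inr_snd, Category.comp_id]
  · obtain ⟨i, hi⟩ := hw.exists_of_sum_pos (by omega)
    rw [h, cxOp, Category.assoc, Category.assoc, twoTermProj_incl_one]
    apply biprod.hom_ext
    · simp only [Category.assoc, biprod.inl_fst, Category.comp_id]
    · simp only [Category.assoc, semiOp_snd, biprod.inl_snd, comp_zero]
      rw [← whiskerLeft_comp_assoc, ← tensMap_comp,
        tensMap_eq_zero _ i (twoTermIncl_snd _ (by omega)),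
        MonoidalPreadditive.whiskerLeft_zero, zero_comp]

theorem cxOp_comp (a b m : ℕ) (w : Fin (a + m + b) → ℤ) (w' : Fin (a + 1 + b) → ℤ) (k : ℤ)
    (h : ∑ i, w i = k) (hl : ∀ i, w (posL a m b i) = w' (posL a 1 b i))
    (hm : ∑ i, w (posM a m b i) = w' (posM a 1 b 0))
    (hr : ∀ i, w (posR a m b i) = w' (posR a 1 b i)) :
    P.comp a b m ▷ tens (fun i => M.cx.X (w i)) ≫ M.cxOp w k =
      (α_ _ _ _).hom ≫
        P.obj (a + 1 + b) ◁ plug a m b (F := fun i => M.cx.X (w i)) (G := fun i => M.cx.X (w' i))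
          (fun i => eqToHom (congrArg M.cx.X (hl i)))
          (M.cxOp (fun i => w (posM a m b i)) _)
          (fun i => eqToHom (congrArg M.cx.X (hr i))) ≫
        M.cxOp w' k := by
  by_cases hk : k ≠ 0 ∧ k ≠ 1
  · exact (twoTerm_inDegrees M.d.hom k hk.1 hk.2).eq_of_tgt _ _
  by_cases hw : IsBinary w
  swap
  · exact (M.isZero_source hw _).eq_of_src _ _
  -- The outer blocks have nonnegative degree and the total is at most one; hence `cxOp_incl`
  -- applies to the inner operation.
  have hle : ∑ i, w (posM a m b i) ≤ 1 := by
    have hL := Finset.sum_nonneg fun i (_ : i ∈ Finset.univ) => hw.nonneg (posL a m b i)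
    have hR := Finset.sum_nonneg fun i (_ : i ∈ Finset.univ) => hw.nonneg (posR a m b i)
    rw [Fin.sum_univ_add, Fin.sum_univ_add] at h
    simp only [posL, posM, posR] at hL hR ⊢
    omega
  have hmid : M.cxOp (fun i => w (posM a m b i)) (w' (posM a 1 b 0)) ≫
        twoTermIncl M.d.hom (w' (posM a 1 b 0)) =
      P.obj m ◁ tensMap (fun i => twoTermIncl M.d.hom (w (posM a m b i))) ≫ M.semiOp m := by
    rw [← hm]
    exact M.cxOp_incl (fun i => hw _) hle
  have hL : (fun i => eqToHom (congrArg M.cx.X (hl i)) ≫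
      twoTermIncl M.d.hom (w' (posL a 1 b i))) =
      fun i => twoTermIncl M.d.hom (w (posL a m b i)) ≫ 𝟙 _ :=
    funext fun i => by rw [eqToHom_twoTermIncl M.d.hom (hl i), Category.comp_id]
  have hR : (fun i => eqToHom (congrArg M.cx.X (hr i)) ≫
      twoTermIncl M.d.hom (w' (posR a 1 b i))) =
      fun i => twoTermIncl M.d.hom (w (posR a m b i)) ≫ 𝟙 _ :=
    funext fun i => by rw [eqToHom_twoTermIncl M.d.hom (hr i), Category.comp_id]
  rw [cxOp, cxOp.eq_1 M w', ← whiskerLeft_comp_assoc, plug_tensMap, hmid, hL, hR,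
    ← whisker_exchange_assoc, reassoc_of% M.semiOp_comp, tensor_whiskerLeft, Category.assoc,
    Category.assoc, Iso.inv_hom_id_assoc, ← whiskerLeft_comp_assoc, whiskerLeft_tensMap_plug]

/-- By equivariance the left side is the self-action of `V₀` after `d ⊕ 1`. Its correction term,
supported on arguments all in the second copy, vanishes because argument `i` comes from `V₁`;
folding the two copies leaves `d` on that argument and the identity on the others. -/
theorem cxOp_d_one {n : ℕ} {w : Fin n → ℤ} {i : Fin n} (hi : w i = 1)
    (h0 : ∀ j, j ≠ i → w j = 0) :
    M.cxOp w 1 ≫ M.cx.d 1 0 = P.obj n ◁ dAt M.cx w i ≫ M.cxOp (lower w i) 0 := by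
  have h₁ (j : Fin n) : twoTermIncl M.d.hom (w j) ≫ biprod.map M.d.hom (𝟙 M.base.X) ≫
      biprod.snd ≫ (biprod.inr : M.base.X ⟶ M.base.X ⊞ M.base.X) =
      twoTermIncl M.d.hom (w j) ≫ biprod.snd ≫ biprod.inr := by
    rw [biprod.map_snd_assoc, Category.id_comp]
  have hz : tensMap (fun j => twoTermIncl M.d.hom (w j)) ≫
      tensMap (fun _ => biprod.map M.d.hom (𝟙 M.base.X)) ≫ tensMap (fun _ : Fin n =>
        (biprod.snd ≫ biprod.inr : M.base.X ⊞ M.base.X ⟶ M.base.X ⊞ M.base.X)) = 0 := by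
    rw [← tensMap_comp, ← tensMap_comp]
    exact tensMap_eq_zero _ i (by
      rw [h₁, ← Category.assoc, twoTermIncl_snd _ (by omega), zero_comp])
  have h₂ : (fun j => twoTermIncl M.d.hom (w j) ≫ biprod.map M.d.hom (𝟙 M.base.X) ≫
      biprod.desc (𝟙 M.base.X) (𝟙 M.base.X)) = fun j => (twoTermIncl M.d.hom (w j) ≫
        if j = i then biprod.fst ≫ M.d.hom ≫ biprod.inr else 𝟙 _) ≫ biprod.snd := by
    funext j
    have e : biprod.map M.d.hom (𝟙 M.base.X) ≫ biprod.desc (𝟙 M.base.X) (𝟙 M.base.X) =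
        biprod.fst ≫ M.d.hom + biprod.snd := by
      apply biprod.hom_ext' <;> simp
    rw [e, Category.assoc]
    split_ifs with hj
    · rw [Preadditive.comp_add, twoTermIncl_snd _ (by rw [hj]; omega)]
      simp
    · rw [Preadditive.comp_add, ← Category.assoc _ biprod.fst,
        twoTermIncl_fst _ (by rw [h0 j hj]; omega)]
      simp
  have key : tensMap (fun j => twoTermIncl M.d.hom (w j)) ≫
      tensMap (fun _ => biprod.map M.d.hom (𝟙 M.base.X)) ≫
      (𝟙 _ - tensMap (fun _ : Fin n =>
        (biprod.snd ≫ biprod.inr : M.base.X ⊞ M.base.X ⟶ M.base.X ⊞ M.base.X))) ≫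
      tensMap (fun _ => biprod.desc (𝟙 M.base.X) (𝟙 M.base.X)) =
      (dAt M.cx w i ≫ tensMap (fun j => twoTermIncl M.d.hom (lower w i j))) ≫
        tensMap (fun _ => biprod.snd) := by
    rw [dAt_tensMap_twoTermIncl M.d.hom hi, ← tensMap_comp, ← h₂, Preadditive.sub_comp,
      Preadditive.comp_sub, Preadditive.comp_sub, Category.id_comp, reassoc_of% hz, zero_comp,
      sub_zero, ← tensMap_comp, ← tensMap_comp]
  have key' := congrArg
    (fun f => P.obj n ◁ f ≫ M.base.op n ≫ biprod.inr ≫ twoTermProj M.d.hom 0) key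
  rw [cxOp, cxOp, Category.assoc, Category.assoc, twoTermProj_d, reassoc_of% M.semiOp_fst,
    reassoc_of% (M.equivariant n), selfAction, ← snd_inr_twoTermProj_zero, reassoc_of% M.semiOp_snd]
  simpa only [MonoidalCategory.whiskerLeft_comp, Category.assoc, biprod.inr_snd_assoc] using key'

variable {M}

theorem Peiffer.cxOp_d (hM : M.Peiffer) {n : ℕ} (w : Fin n → ℤ) (k : ℤ) (h : ∑ i, w i = k) :
    M.cxOp w k ≫ M.cx.d k (k - 1) =
      ∑ i, (∑ j ∈ Finset.Iio i, w j).negOnePow •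
        (P.obj n ◁ dAt M.cx w i ≫ M.cxOp (lower w i) (k - 1)) := by
  by_cases hw : IsBinary w
  swap
  · exact (M.isZero_source hw _).eq_of_src _ _
  have hz (i : Fin n) (hi : w i ≠ 1) : (∑ j ∈ Finset.Iio i, w j).negOnePow •
      (P.obj n ◁ dAt M.cx w i ≫ M.cxOp (lower w i) (k - 1)) = 0 := by
    rw [dAt_twoTerm_eq_zero M.d.hom hi, MonoidalPreadditive.whiskerLeft_zero, zero_comp, smul_zero]
  by_cases h1 : k = 1
  · subst h1
    obtain ⟨i, hi, h0⟩ := hw.exists_of_sum_eq_one h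
    rw [Finset.sum_eq_single i (fun j _ hj => hz j (by rw [h0 j hj]; omega))
      (fun hi => absurd (Finset.mem_univ i) hi),
      Finset.sum_eq_zero fun j hj => h0 j (Finset.mem_Iio.1 hj).ne, Int.negOnePow_zero, one_smul]
    exact M.cxOp_d_one hi h0
  by_cases h2 : k = 2
  · subst h2
    obtain ⟨p, q, hpq, hp, hq, h0⟩ := hw.exists_of_sum_eq_two h
    have hsp : ∑ j ∈ Finset.Iio p, w j = 0 := Finset.sum_eq_zero fun j hj =>
      h0 j (Finset.mem_Iio.1 hj).ne ((Finset.mem_Iio.1 hj).trans hpq).ne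
    have hsq : ∑ j ∈ Finset.Iio q, w j = 1 := by
      rw [Finset.sum_eq_single_of_mem p (Finset.mem_Iio.2 hpq) fun j hj hjp =>
        h0 j hjp (Finset.mem_Iio.1 hj).ne, hp]
    -- The signs at `p` and `q` are `+` and `-`, because the degrees before them sum to `0` and `1`;
    -- equality of the unsigned terms thus gives cancellation.
    have hcancel : P.obj n ◁ dAt M.cx w p ≫ M.cxOp (lower w p) (2 - 1) =
        P.obj n ◁ dAt M.cx w q ≫ M.cxOp (lower w q) (2 - 1) :=
      (hM.dAt_cxOp hpq.ne' hq hp fun j h₁ h₂ => h0 j h₂ h₁).trans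
        (hM.dAt_cxOp hpq.ne hp hq h0).symm
    rw [Finset.sum_eq_add p q hpq.ne
      (fun j _ hj => hz j (by rw [h0 j hj.1 hj.2]; omega))
      (fun hi => absurd (Finset.mem_univ _) hi) (fun hi => absurd (Finset.mem_univ _) hi),
      hsp, hsq, Int.negOnePow_zero, one_smul, Int.negOnePow_one, Units.neg_smul, one_smul,
      hcancel, add_neg_cancel, twoTerm_d_eq_zero M.d.hom (by omega), comp_zero]
  · exact (twoTerm_inDegrees M.d.hom (k - 1) (by omega) (by omega)).eq_of_tgt _ _

/-- The differential graded algebra structure on the complex of a crossed module. -/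
def Peiffer.str (hM : M.Peiffer) : DGStr P M.cx where
  op w k _ := M.cxOp w k
  op_d := hM.cxOp_d
  op_act σ w k h := by
    by_cases hk : k ≠ 0 ∧ k ≠ 1
    · exact (twoTerm_inDegrees M.d.hom k hk.1 hk.2).eq_of_tgt _ _
    by_cases hw : IsBinary w
    swap
    · exact (M.isZero_source hw _).eq_of_src _ _
    rw [hw.koszulSign_eq_one (by omega), one_smul, cxOp_act]
  op_unit w := (M.cxOp_unit w _ rfl).trans (by rw [eqToHom_refl, Category.comp_id])
  op_comp a b m w w' k h _ hl hm hr := M.cxOp_comp a b m w w' k h hl hm hr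

theorem Peiffer.isInduced_str (hM : M.Peiffer) : M.IsInduced hM.str where
  degree_zero := M.cxOp_const_zero
  degree_one w _ := M.cxOp_one w
  degree_ge_two _ k _ hk := (twoTerm_inDegrees M.d.hom k (by omega) (by omega)).eq_of_tgt _ _

/-- A binary word of sum zero is constantly zero, so the prescription covers every component whose
source and target are not forced to vanish. -/
theorem IsInduced.eq {s t : DGStr P M.cx} (hs : M.IsInduced s) (ht : M.IsInduced t) : s = t := by
  apply DGStr.ext
  funext n w k h
  by_cases hw : IsBinary w
  swap
  · exact (M.isZero_source hw _).eq_of_src _ _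
  by_cases h0 : k = 0
  · subst h0
    obtain rfl : w = fun _ => 0 := funext (hw.eq_zero_of_sum h)
    exact (hs.degree_zero n).trans (ht.degree_zero n).symm
  by_cases h1 : k = 1
  · subst h1
    rw [hs.degree_one, ht.degree_one]
  · exact (twoTerm_inDegrees M.d.hom k h0 h1).eq_of_tgt _ _

end Preadditive

/-! ### Functoriality. -/

theorem semiOp_map {M N : PreXMod P} (φ : M ⟶ N) (n : ℕ) :
    M.semiOp n ≫ biprod.map φ.top.hom φ.base.hom =
      P.obj n ◁ tensMap (fun _ => biprod.map φ.top.hom φ.base.hom) ≫ N.semiOp n := by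
  apply biprod.hom_ext
  · simp only [Category.assoc, biprod.map_fst, semiOp_fst, reassoc_of% M.semiOp_fst]
    exact φ.action n
  · simp only [Category.assoc, biprod.map_snd, semiOp_snd, reassoc_of% M.semiOp_snd]
    rw [φ.base.op_hom, ← whiskerLeft_comp_assoc, ← whiskerLeft_comp_assoc, ← tensMap_comp,
      ← tensMap_comp]
    simp only [biprod.map_snd]

theorem cxOp_map {M N : PreXMod P} (φ : M ⟶ N) {n : ℕ} (w : Fin n → ℤ) (k : ℤ) :
    M.cxOp w k ≫ (cxMap φ).f k =
      P.obj n ◁ tensMap (fun i => (cxMap φ).f (w i)) ≫ N.cxOp w k := by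
  have e : (fun i => twoTermIncl M.d.hom (w i) ≫ biprod.map φ.top.hom φ.base.hom) =
      fun i => (cxMap φ).f (w i) ≫ twoTermIncl N.d.hom (w i) :=
    funext fun i => (twoTermMap_incl _ _ _ _).symm
  rw [cxOp, cxOp, Category.assoc, Category.assoc, twoTermProj_map, ← Category.assoc (M.semiOp n),
    semiOp_map, Category.assoc, ← whiskerLeft_comp_assoc, ← whiskerLeft_comp_assoc,
    ← tensMap_comp, ← tensMap_comp, e]

theorem cxMap_id (M : PreXMod P) : cxMap (𝟙 M) = 𝟙 M.cx := by
  ext k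
  match k with
  | .ofNat 0 => rfl
  | .ofNat 1 => rfl
  | .ofNat (_ + 2) => exact (isZero_zero C).eq_of_src _ _
  | .negSucc _ => exact (isZero_zero C).eq_of_src _ _

theorem cxMap_comp {L M N : PreXMod P} (φ : L ⟶ M) (ψ : M ⟶ N) :
    cxMap (φ ≫ ψ) = cxMap φ ≫ cxMap ψ := by
  ext k
  match k with
  | .ofNat 0 => rfl
  | .ofNat 1 => rfl
  | .ofNat (_ + 2) => exact (isZero_zero C).eq_of_src _ _
  | .negSucc _ => exact (isZero_zero C).eq_of_src _ _

/-- The functor from crossed modules to differential graded algebras in degrees `0` and `1`. -/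
def toDGFunctor (P : SymmOperad C) [MonoidalPreadditive C] : XMod P ⥤ DGAlgLEOne P where
  obj M := M.obj.toDG M.property.str
  map φ := ⟨⟨cxMap φ.hom, fun w k _ => cxOp_map φ.hom w k⟩⟩
  map_id M := by
    apply ObjectProperty.hom_ext
    exact DGAlg.Hom.ext (cxMap_id M.obj)
  map_comp φ ψ := by
    apply ObjectProperty.hom_ext
    exact DGAlg.Hom.ext (cxMap_comp φ.hom ψ.hom)

end PreXMod

end

end OpdX


theorem mainTheorem9 {C : Type u} [Category.{v} C] [Abelian C] [HasLimits C] [HasColimits C]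
    [MonoidalCategory C] [SymmetricCategory C] [MonoidalClosed C]
    (P : OpdX.SymmOperad C) (hP : P.IsReduced) :
    ∃ s : ∀ M : OpdX.XMod P, OpdX.DGStr P M.obj.cx,
      (∀ M : OpdX.XMod P, M.obj.IsInduced (s M)) ∧
      (∀ (M : OpdX.XMod P) (t : OpdX.DGStr P M.obj.cx), M.obj.IsInduced t → t = s M) ∧
      ∃ (Φ : OpdX.XMod P ⥤ OpdX.DGAlgLEOne P) (hΦ : ∀ M, Φ.obj M = M.obj.toDG (s M)),
        ∀ (M N : OpdX.XMod P) (φ : M ⟶ N),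
          (Φ.map φ).hom.hom =
            eqToHom (congrArg (fun A => A.obj.cx) (hΦ M)) ≫ OpdX.PreXMod.cxMap φ.hom ≫
              eqToHom (congrArg (fun A => A.obj.cx) (hΦ N).symm) := by
  have : MonoidalPreadditive C := OpdX.monoidalPreadditive_of_closed
  refine ⟨fun M => M.property.str, fun M => M.property.isInduced_str,
    fun M t ht => ht.eq M.property.isInduced_str, OpdX.PreXMod.toDGFunctor P, fun _ => rfl, ?_⟩
  -- The functor has the prescribed objects definitionally, so both transports are identities.
  exact fun M N φ => ((Category.id_comp _).trans (Category.comp_id _)).symm
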